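/- Let $d\ge 2$ be an integer. For $k,\alpha>0$ and $(s,\rho)\in\mathbb R\times[0,\infty)$ put $$p_{\alpha,k}(s,\rho)=s^{-(d+2-\alpha)/2}e^{-\rho^2/(ks)}\ \text{ if } s>0,\qquad p_{\alpha,k}(s,\rho)=0\ \text{ if } s\le 0,$$ and for a function $f$ on $\mathbb R^{d+1}=\{(t,x):t\in\mathbb R,\ x\in\mathbb R^d\}$ put $$P_{\alpha,k}f(t,x)=\int_{\mathbb R^{d+1}}p_{\alpha,k}(s,|y|)\,f(t+s,x+y)\,dy\,ds .$$ For $r',s'\in(1,\infty)$ let $$\|f\|_{L_{r',s'}}=\Big(\int_{\mathbb R}\Big(\int_{\mathbb R^d}|f(t,x)|^{s'}dx\Big)^{r'/s'}dt\Big)^{1/r'},$$ and for a real-valued or $\mathbb R^d$-valued function $b$ on $\mathbb R^{d+1}$ let $$\tilde b_{\alpha,p_0}=\sup_{t\in\mathbb R}\ \sup_{r>0}\ r^{\alpha}\sup_{x\in\mathbb R^d}\Big(\frac1{|B_r(x)|}\int_{B_r(x)}|b(t,y)|^{p_0}\,dy\Big)^{1/p_0}\in[0,\infty]$$ be its $(\alpha,p_0)$-Morrey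 norm, where $B_r(x)$ is the ball of radius $r$ centred at $x$. Let $p_0\in(1,d]$, $\alpha\in(0,d/p_0]$, $k>0$ and $1<r',s'<p_0$. Then there is a finite constant $N$, depending only on $d,\alpha,r',s',p_0,k$, such that for every Borel measurable real-valued $f$ on $\mathbb R^{d+1}$ with $\|f\|_{L_{r',s'}}<\infty$ the integral defining $P_{\alpha,k}f(t,x)$ converges absolutely for almost every $(t,x)$, and for every Borel measurable real-valued or $\mathbb R^d$-valued $b$ on $\mathbb R^{d+1}$ $$\|b\,P_{\alpha,k}f\|_{L_{r',s'}}\le N\,\tilde b_{\alpha,p_0}\,\|f\|_{L_{r',s'}}$$ (with the convention $0\cdot\infty=0$ on the right-hand side). -/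

import Mathlib

open MeasureTheory
open scoped ENNReal NNReal

namespace ParabolicPotential

noncomputable section

/-- The space-time `ℝ^{d+1}` of points `(t, x)`, with `t` real and `x` in Euclidean `ℝ^d`.
Its `volume` is Lebesgue measure `dt dx`. -/
abbrev SpaceTime (d : ℕ) : Type := ℝ × EuclideanSpace ℝ (Fin d)

/-- The kernel `p_{α,k}(s, ρ) = s^{-(d+2-α)/2} exp (-ρ² / (k s))` for `s > 0`, and `0` for
`s ≤ 0`. -/
def kernel (d : ℕ) (α k s ρ : ℝ) : ℝ :=
  if 0 < s then Real.exp (-ρ ^ 2 / (k * s)) / s ^ (((d : ℝ) + 2 - α) / 2) else 0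

/-- The integrand `(s, y) ↦ p_{α,k}(s, |y|) f(t + s, x + y)` of the potential at `(t, x)`. -/
def potentialIntegrand {d : ℕ} (α k : ℝ) (f : SpaceTime d → ℝ) (z w : SpaceTime d) : ℝ :=
  kernel d α k w.1 ‖w.2‖ * f (z + w)

/-- The operator `P_{α,k} f (t, x) = ∫ p_{α,k}(s, |y|) f(t + s, x + y) dy ds`. -/
def potential {d : ℕ} (α k : ℝ) (f : SpaceTime d → ℝ) (z : SpaceTime d) : ℝ :=
  ∫ w : SpaceTime d, potentialIntegrand α k f z w

/-- The mixed norm `‖f‖_{L_{q,p}} = (∫ (∫ |f(t,x)|^p dx)^{q/p} dt)^{1/q}`, with values in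
`[0, ∞]`: exponent `p` in space (inner integral), exponent `q` in time (outer integral). -/
def mixedNorm {d : ℕ} {F : Type*} [NormedAddCommGroup F] (q p : ℝ) (f : SpaceTime d → F) :
    ℝ≥0∞ :=
  (∫⁻ t : ℝ, (∫⁻ x : EuclideanSpace ℝ (Fin d), ‖f (t, x)‖ₑ ^ p) ^ (q / p)) ^ (1 / q)

/-- The `(α, p₀)`-Morrey norm
`sup_t sup_{r>0} r^α sup_x (|B_r(x)|⁻¹ ∫_{B_r(x)} |b(t,y)|^{p₀} dy)^{1/p₀}`, with values in
`[0, ∞]`; the supremum in `t` is a genuine supremum over all real `t`. -/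
def morreyNorm {d : ℕ} {F : Type*} [NormedAddCommGroup F] (α p₀ : ℝ) (b : SpaceTime d → F) :
    ℝ≥0∞ :=
  ⨆ (t : ℝ) (r : ℝ) (_ : 0 < r), ENNReal.ofReal (r ^ α) *
    ⨆ x : EuclideanSpace ℝ (Fin d),
      ((volume (Metric.ball x r))⁻¹ * ∫⁻ y in Metric.ball x r, ‖b (t, y)‖ₑ ^ p₀) ^ (1 / p₀)

end

end ParabolicPotential

namespace ParabolicPotential

noncomputable section

/-! The kernel is dominated by the dyadic parabolic Riesz kernel `rieszKer`, so everything reduces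
to bounds for `b * rieszPot α f`, where the integrals of `b ^ q` (`q` being the Morrey exponent)
over balls in time slices are bounded uniformly in time (`SliceBound`).

For equal exponents in space and time, `schur_test` asks for a test function `H` such that
`rieszPot` maps `H` below `W`, and `V * b ^ p * W ^ (p - 1)` below `V * H ^ (p - 1)`, up to
constants. The test function is built from a potential `Ω` of small order `ε` of `b ^ q * U`, where
`U` is a time weight (`weightedPot`). With `α q = ε + δ`, the averages of `b ^ q * U` over a
cylinder of size `2 ^ i` are at most the average of `U` times both `2 ^ (-ε i) Ω` (one term of the
series for `Ω`) and `2 ^ (-α q i)` (the slice bound). The averages of `Ω * U` obey the same with `Ω`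
and `2 ^ (-δ i)`, because `Ω` behaves like an `A₁` weight (`scaleBound_weightedPot`). Such double
bounds (`ScaleBound`) interpolate by Hölder, and summing them against `2 ^ (α i)` turns the minimum
into a power of `Ω` (`ScaleBound.rieszPot_le`). Since `p < q`, there is room to choose exponents
meeting both Schur conditions.

The resulting estimate holds for the time weights `U` and `U ^ (1 - p)` for every `U` in `A₁`, with
a constant controlled by the `A₁` constant (`weighted_bound`). Rubio de Francia extrapolation in
time, with `A₁` majorants made by iterating the maximal function (`exists_isA1_majorant`), moves the
time exponent from `p` to any `r > 1` (`mixed_bound`).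

Absolute convergence is the same bound with `b` the indicator of a ball, which has the slice bound
because `α q ≤ d`. -/

/-- The extended nonnegative real `2 ^ x`. -/
def tw (x : ℝ) : ℝ≥0∞ := 2 ^ x

lemma tw_add (x y : ℝ) : tw (x + y) = tw x * tw y :=
  ENNReal.rpow_add x y two_ne_zero ENNReal.ofNat_ne_top

lemma tw_zero : tw 0 = 1 := ENNReal.rpow_zero

lemma tw_ne_zero (x : ℝ) : tw x ≠ 0 := by
  simp [tw, ENNReal.rpow_eq_zero_iff]

lemma tw_ne_top (x : ℝ) : tw x ≠ ⊤ := by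
  simp [tw, ENNReal.rpow_eq_top_iff]

lemma tw_mul_tw_neg (x : ℝ) : tw x * tw (-x) = 1 := by
  rw [← tw_add, add_neg_cancel, tw_zero]

lemma tw_rpow (x y : ℝ) : tw x ^ y = tw (x * y) := (ENNReal.rpow_mul 2 x y).symm

lemma tw_mono {x y : ℝ} (h : x ≤ y) : tw x ≤ tw y :=
  ENNReal.rpow_le_rpow_of_exponent_le (by norm_num) h

lemma tw_lt_tw {x y : ℝ} : tw x < tw y ↔ x < y := by
  constructor
  · intro h
    by_contra! h'
    exact absurd (tw_mono h') (not_le.2 h)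
  · intro h
    exact ENNReal.rpow_lt_rpow_of_exponent_lt (by norm_num) ENNReal.ofNat_ne_top h

lemma ofReal_two_rpow (x : ℝ) : ENNReal.ofReal ((2 : ℝ) ^ x) = tw x := by
  rw [tw, ← ENNReal.ofReal_rpow_of_pos two_pos, ENNReal.ofReal_ofNat]

lemma exists_eq_tw {X : ℝ≥0∞} (h0 : X ≠ 0) (ht : X ≠ ⊤) : ∃ x, X = tw x := by
  have hpos : 0 < X.toReal := ENNReal.toReal_pos h0 ht
  refine ⟨Real.logb 2 X.toReal, ?_⟩
  rw [← ofReal_two_rpow, Real.rpow_logb two_pos (by norm_num) hpos, ENNReal.ofReal_toReal ht]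

/-! ### Geometric series in powers of two. -/

lemma tsum_nat_tw_ne_top {σ : ℝ} (hσ : 0 < σ) : ∑' n : ℕ, tw (-σ * n) ≠ ⊤ := by
  have h : ∀ n : ℕ, tw (-σ * n) = tw (-σ) ^ n := by
    intro n
    rw [← tw_rpow, ENNReal.rpow_natCast]
  simp_rw [h]
  rw [ENNReal.tsum_geometric]
  have : tw (-σ) < 1 := by
    rw [← tw_zero, tw_lt_tw]; linarith
  exact ENNReal.inv_ne_top.2 (tsub_pos_of_lt this).ne'

/-- Two-sided geometric series centred at an arbitrary real number. -/
lemma tsum_tw_abs {σ : ℝ} (hσ : 0 < σ) :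
    ∃ C : ℝ≥0∞, C ≠ ⊤ ∧ ∀ x : ℝ, ∑' j : ℤ, tw (-σ * |j - x|) ≤ C := by
  refine ⟨tw σ * (2 * ∑' n : ℕ, tw (-σ * n)), ?_, fun x => ?_⟩
  · exact ENNReal.mul_ne_top (tw_ne_top _)
      (ENNReal.mul_ne_top ENNReal.ofNat_ne_top (tsum_nat_tw_ne_top hσ))
  · have h1 : ∀ j : ℤ, tw (-σ * |j - x|) ≤ tw σ * tw (-σ * |((j - ⌊x⌋ : ℤ) : ℝ)|) := by
      intro j
      rw [← tw_add]
      apply tw_mono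
      have h2 : |((j - ⌊x⌋ : ℤ) : ℝ)| ≤ |j - x| + 1 := by
        push_cast
        have := Int.floor_le x
        have := Int.lt_floor_add_one x
        rcases abs_cases ((j : ℝ) - ⌊x⌋) with h | h <;> rcases abs_cases ((j : ℝ) - x) with h' | h' <;>
          linarith
      nlinarith
    refine (ENNReal.tsum_le_tsum h1).trans ?_
    rw [ENNReal.tsum_mul_left]
    gcongr
    refine ((Equiv.subRight ⌊x⌋).tsum_eq (fun j : ℤ => tw (-σ * |(j : ℝ)|))).trans_le ?_
    rw [tsum_of_nat_of_neg_add_one ENNReal.summable ENNReal.summable, two_mul]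
    gcongr with n n
    · simp
    · push_cast
      rw [abs_neg, abs_of_nonneg (by positivity)]
      apply tw_mono
      nlinarith

lemma tsum_tw_ge {σ : ℝ} (hσ : 0 < σ) :
    ∃ C : ℝ≥0∞, C ≠ ⊤ ∧ ∀ i : ℤ, ∑' j : ℤ, (if i ≤ j then tw (-σ * j) else 0) ≤ C * tw (-σ * i) := by
  obtain ⟨C, hC, h⟩ := tsum_tw_abs hσ
  refine ⟨C, hC, fun i => ?_⟩
  refine le_trans ?_ (mul_le_mul_left (h i) _)
  rw [← ENNReal.tsum_mul_right]
  refine ENNReal.tsum_le_tsum fun j => ?_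
  split_ifs with hij
  · rw [← tw_add]
    apply tw_mono
    have : (i : ℝ) ≤ j := by exact_mod_cast hij
    rw [abs_of_nonneg (by linarith)]
    linarith
  · exact zero_le

lemma tsum_tw_le {σ : ℝ} (hσ : 0 < σ) :
    ∃ C : ℝ≥0∞, C ≠ ⊤ ∧ ∀ i : ℤ, ∑' j : ℤ, (if j ≤ i then tw (σ * j) else 0) ≤ C * tw (σ * i) := by
  obtain ⟨C, hC, h⟩ := tsum_tw_abs hσ
  refine ⟨C, hC, fun i => ?_⟩
  refine le_trans ?_ (mul_le_mul_left (h i) _)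
  rw [← ENNReal.tsum_mul_right]
  refine ENNReal.tsum_le_tsum fun j => ?_
  split_ifs with hij
  · rw [← tw_add]
    apply tw_mono
    have : (j : ℝ) ≤ i := by exact_mod_cast hij
    rw [abs_of_nonpos (by linarith)]
    linarith
  · exact zero_le

lemma tsum_tw_lt {σ : ℝ} (hσ : 0 < σ) :
    ∃ C : ℝ≥0∞, C ≠ ⊤ ∧ ∀ X : ℝ≥0∞,
      ∑' j : ℤ, (if tw j < X then tw (σ * j) else 0) ≤ C * X ^ σ := by
  obtain ⟨C, hC, h⟩ := tsum_tw_abs hσ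
  -- Adding 1 makes the constant nonzero, so that the right side is `⊤` when `X = ⊤`.
  refine ⟨C + 1, by simp [hC], fun X => ?_⟩
  rcases eq_or_ne X 0 with rfl | h0
  · simp
  rcases eq_or_ne X ⊤ with rfl | ht
  · simp [ENNReal.top_rpow_of_pos hσ]
  obtain ⟨x, rfl⟩ := exists_eq_tw h0 ht
  refine le_trans ?_ (mul_le_mul_left ((h x).trans le_self_add) _)
  rw [← ENNReal.tsum_mul_right]
  refine ENNReal.tsum_le_tsum fun j => ?_
  split_ifs with hij
  · rw [tw_lt_tw] at hij
    rw [tw_rpow, ← tw_add]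
    apply tw_mono
    rw [abs_of_nonpos (by linarith)]
    linarith
  · exact zero_le

/-- Summation of a series whose terms are controlled by one power of `X` at small scales and
decay at large scales. -/
lemma tsum_tw_min {α δ ε θ : ℝ} (hδ : 0 < δ) (hε : ε < α) (hη : α < ε + δ * θ) :
    ∃ C : ℝ≥0∞, C ≠ ⊤ ∧ ∀ X : ℝ≥0∞,
      ∑' i : ℤ, tw (α * i) * min (tw (-ε * i) * X ^ θ) (tw (-(ε + δ * θ) * i)) ≤
        C * X ^ ((ε + δ * θ - α) / δ) := by
  obtain ⟨C, hC, h⟩ := tsum_tw_abs (σ := min (α - ε) (ε + δ * θ - α))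
    (lt_min (by linarith) (by linarith))
  have hθ : 0 < θ := by
    by_contra! h
    nlinarith
  have he : 0 < (ε + δ * θ - α) / δ := div_pos (by linarith) hδ
  refine ⟨C + 1, by simp [hC], fun X => ?_⟩
  rcases eq_or_ne X 0 with rfl | h0
  · simp [ENNReal.zero_rpow_of_pos hθ]
  rcases eq_or_ne X ⊤ with rfl | ht
  · simp [ENNReal.top_rpow_of_pos he]
  obtain ⟨y, rfl⟩ := exists_eq_tw h0 ht
  -- With `X = 2 ^ (-δ x)` the two bounds in the minimum cross at `i = x`, so the terms decay
  -- geometrically on both sides of `x`.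
  obtain ⟨x, rfl⟩ : ∃ x, y = -δ * x := ⟨-y / δ, by field_simp⟩
  refine le_trans ?_ (mul_le_mul_left ((h x).trans le_self_add) _)
  rw [← ENNReal.tsum_mul_right]
  refine ENNReal.tsum_le_tsum fun j => ?_
  rw [tw_rpow, tw_rpow, ← tw_add, ← tw_add]
  have e1 : -δ * x * ((ε + δ * θ - α) / δ) = -x * (ε + δ * θ - α) := by field_simp
  rw [e1]
  rcases le_total (j : ℝ) x with hj | hj
  · refine (mul_le_mul_right (min_le_left _ _) _).trans ?_
    rw [← tw_add]
    apply tw_mono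
    rw [abs_of_nonpos (by linarith)]
    have := mul_le_mul_of_nonneg_right (min_le_left (α - ε) (ε + δ * θ - α)) (sub_nonneg.2 hj)
    linarith
  · refine (mul_le_mul_right (min_le_right _ _) _).trans ?_
    rw [← tw_add]
    apply tw_mono
    rw [abs_of_nonneg (by linarith)]
    have := mul_le_mul_of_nonneg_right (min_le_right (α - ε) (ε + δ * θ - α)) (sub_nonneg.2 hj)
    linarith

/-! ### Parabolic cylinders and averages over them. -/

variable {d : ℕ}

lemma two_rpow_add_one_bound {x y z : ℝ} (h : x ≤ y) (hz : y + 1 ≤ z) :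
    (2 : ℝ) ^ x + 2 ^ y ≤ 2 ^ z := by
  have h1 : (2 : ℝ) ^ x ≤ 2 ^ y := Real.rpow_le_rpow_of_exponent_le one_le_two h
  have h2 : (2 : ℝ) ^ (y + 1) ≤ 2 ^ z := Real.rpow_le_rpow_of_exponent_le one_le_two hz
  rw [Real.rpow_add two_pos, Real.rpow_one] at h2
  linarith

lemma ball_subset_ball_two_rpow {X : Type*} [PseudoMetricSpace X] {a b : X} {x y z : ℝ}
    (hab : a ∈ Metric.ball b ((2 : ℝ) ^ x)) (h : x ≤ y) (hz : y + 1 ≤ z) :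
    Metric.ball a ((2 : ℝ) ^ y) ⊆ Metric.ball b ((2 : ℝ) ^ z) := by
  apply Metric.ball_subset_ball'
  have := two_rpow_add_one_bound h hz
  have := Metric.mem_ball.1 hab
  linarith

/-- The normalised integral of `v` over the interval of radius `4 ^ j` about `t`. -/
def timeAvg (j : ℤ) (v : ℝ → ℝ≥0∞) (t : ℝ) : ℝ≥0∞ :=
  tw (-(2 * j)) * ∫⁻ τ in Metric.ball t ((2 : ℝ) ^ (2 * j : ℝ)), v τ

/-- The parabolic cylinder of size `2 ^ j` about `z`. -/
def cyl (j : ℤ) (z : SpaceTime d) : Set (SpaceTime d) :=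
  Metric.ball z.1 ((2 : ℝ) ^ (2 * j : ℝ)) ×ˢ Metric.ball z.2 ((2 : ℝ) ^ (j : ℝ))

/-- The normalised integral of `g` over the cylinder of size `2 ^ j` about `z`. -/
def cylAvg (j : ℤ) (g : SpaceTime d → ℝ≥0∞) (z : SpaceTime d) : ℝ≥0∞ :=
  tw (-((d + 2) * j)) * ∫⁻ w in cyl j z, g w

lemma mem_cyl {j : ℤ} {z w : SpaceTime d} :
    w ∈ cyl j z ↔ dist w.1 z.1 < (2 : ℝ) ^ (2 * j : ℝ) ∧ dist w.2 z.2 < (2 : ℝ) ^ (j : ℝ) := by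
  simp [cyl, Set.mem_prod]

lemma mem_cyl_comm {j : ℤ} {z w : SpaceTime d} : w ∈ cyl j z ↔ z ∈ cyl j w := by
  rw [mem_cyl, mem_cyl, dist_comm w.1, dist_comm w.2]

lemma measurableSet_cyl (j : ℤ) (z : SpaceTime d) : MeasurableSet (cyl j z) :=
  Metric.isOpen_ball.measurableSet.prod Metric.isOpen_ball.measurableSet

lemma measurableSet_cyl_rel (j : ℤ) :
    MeasurableSet {p : SpaceTime d × SpaceTime d | p.2 ∈ cyl j p.1} := by
  simp_rw [mem_cyl]
  have h1 : MeasurableSet {p : SpaceTime d × SpaceTime d |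
      dist p.2.1 p.1.1 < (2 : ℝ) ^ (2 * j : ℝ)} := measurableSet_lt (by fun_prop) (by fun_prop)
  have h2 : MeasurableSet {p : SpaceTime d × SpaceTime d |
      dist p.2.2 p.1.2 < (2 : ℝ) ^ (j : ℝ)} := measurableSet_lt (by fun_prop) (by fun_prop)
  exact h1.inter h2

lemma cyl_subset_cyl {i j : ℤ} (hij : i ≤ j) {z w : SpaceTime d} (h : w ∈ cyl i z) :
    cyl j w ⊆ cyl (j + 1) z := by
  have hij' : (i : ℝ) ≤ j := by exact_mod_cast hij
  apply Set.prod_mono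
  · apply ball_subset_ball_two_rpow h.1 (by linarith)
    push_cast; linarith
  · apply ball_subset_ball_two_rpow h.2 (by linarith)
    push_cast; linarith

lemma measurable_timeAvg {v : ℝ → ℝ≥0∞} (hv : Measurable v) (j : ℤ) :
    Measurable (timeAvg j v) := by
  have h : timeAvg j v = fun t => tw (-(2 * j)) *
      ∫⁻ τ, {p : ℝ × ℝ | dist p.2 p.1 < (2 : ℝ) ^ (2 * j : ℝ)}.indicator (fun p => v p.2) (t, τ) := by
    ext t
    rw [timeAvg, ← lintegral_indicator Metric.isOpen_ball.measurableSet]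
    rfl
  rw [h]
  refine Measurable.const_mul ?_ _
  apply Measurable.lintegral_prod_right'
  apply Measurable.indicator (by fun_prop)
  exact measurableSet_lt (by fun_prop) (by fun_prop)

lemma cylAvg_eq_lintegral (j : ℤ) (g : SpaceTime d → ℝ≥0∞) (z : SpaceTime d) :
    cylAvg j g z = ∫⁻ w, (cyl j z).indicator (fun _ => tw (-((d + 2) * j))) w * g w := by
  rw [cylAvg, ← lintegral_const_mul' _ _ (tw_ne_top _),
    ← lintegral_indicator (measurableSet_cyl j z)]
  congr 1 with w
  by_cases h : w ∈ cyl j z <;> simp [h]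

lemma measurable_indicator_cyl (j : ℤ) (c : ℝ≥0∞) :
    Measurable fun p : SpaceTime d × SpaceTime d => (cyl j p.1).indicator (fun _ => c) p.2 := by
  have : (fun p : SpaceTime d × SpaceTime d => (cyl j p.1).indicator (fun _ => c) p.2) =
      {p : SpaceTime d × SpaceTime d | p.2 ∈ cyl j p.1}.indicator fun _ => c := by
    ext p
    simp [Set.indicator]
  rw [this]
  exact measurable_const.indicator (measurableSet_cyl_rel j)

lemma measurable_cylAvg {g : SpaceTime d → ℝ≥0∞} (hg : Measurable g) (j : ℤ) :
    Measurable (cylAvg j g) := by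
  have h : cylAvg j g = fun z =>
      ∫⁻ w, (cyl j z).indicator (fun _ => tw (-((d + 2) * j))) w * g w :=
    funext (cylAvg_eq_lintegral j g)
  rw [h]
  exact ((measurable_indicator_cyl j _).mul (hg.comp measurable_snd)).lintegral_prod_right'

lemma lintegral_symm_kernel {κ : SpaceTime d → SpaceTime d → ℝ≥0∞}
    (hκ : Measurable fun p : SpaceTime d × SpaceTime d => κ p.1 p.2)
    (hs : ∀ z w, κ z w = κ w z) {g h : SpaceTime d → ℝ≥0∞} (hg : Measurable g)
    (hh : Measurable h) :
    ∫⁻ z, h z * ∫⁻ w, κ z w * g w = ∫⁻ z, (∫⁻ w, κ z w * h w) * g z := by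
  have h1 : ∀ z, h z * ∫⁻ w, κ z w * g w = ∫⁻ w, h z * (κ z w * g w) := by
    intro z
    rw [lintegral_const_mul]
    exact (hκ.comp measurable_prodMk_left).mul hg
  have h2 : ∀ z, (∫⁻ w, κ z w * h w) * g z = ∫⁻ w, κ z w * h w * g z := by
    intro z
    rw [lintegral_mul_const]
    exact (hκ.comp measurable_prodMk_left).mul hh
  simp_rw [h1, h2]
  rw [lintegral_lintegral_swap]
  · refine lintegral_congr fun w => lintegral_congr fun z => ?_
    rw [hs z w]; ring
  · exact ((hh.comp measurable_fst).mul (hκ.mul (hg.comp measurable_snd))).aemeasurable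

lemma indicator_cyl_symm (j : ℤ) (c : ℝ≥0∞) (z w : SpaceTime d) :
    (cyl j z).indicator (fun _ => c) w = (cyl j w).indicator (fun _ => c) z := by
  by_cases h : w ∈ cyl j z
  · simp [h, mem_cyl_comm.1 h]
  · have h' : z ∉ cyl j w := fun h' => h (mem_cyl_comm.1 h')
    simp [h, h']

lemma lintegral_mul_cylAvg (j : ℤ) {g h : SpaceTime d → ℝ≥0∞} (hg : Measurable g)
    (hh : Measurable h) : ∫⁻ z, h z * cylAvg j g z = ∫⁻ z, cylAvg j h z * g z := by
  simp_rw [cylAvg_eq_lintegral]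
  exact lintegral_symm_kernel (measurable_indicator_cyl j _) (indicator_cyl_symm j _) hg hh

lemma cylAvg_mono {g h : SpaceTime d → ℝ≥0∞} (hgh : ∀ z, g z ≤ h z) (j : ℤ) (z : SpaceTime d) :
    cylAvg j g z ≤ cylAvg j h z := by
  unfold cylAvg
  gcongr
  exact hgh _

lemma cylAvg_mono_on {g h : SpaceTime d → ℝ≥0∞} (j : ℤ) (z : SpaceTime d)
    (hgh : ∀ w ∈ cyl j z, g w ≤ h w) : cylAvg j g z ≤ cylAvg j h z := by
  unfold cylAvg
  gcongr 1
  exact setLIntegral_mono' (measurableSet_cyl j z) hgh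

lemma cylAvg_const_mul {g : SpaceTime d → ℝ≥0∞} (hg : Measurable g) (c : ℝ≥0∞) (j : ℤ)
    (z : SpaceTime d) : cylAvg j (fun w => c * g w) z = c * cylAvg j g z := by
  rw [cylAvg, lintegral_const_mul _ hg, cylAvg]
  ring

lemma cylAvg_tsum {g : ℤ → SpaceTime d → ℝ≥0∞} (hg : ∀ i, Measurable (g i)) (j : ℤ)
    (z : SpaceTime d) : cylAvg j (fun w => ∑' i, g i w) z = ∑' i, cylAvg j (g i) z := by
  simp_rw [cylAvg]
  rw [lintegral_tsum fun i => (hg i).aemeasurable, ENNReal.tsum_mul_left]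

lemma cylAvg_le_of_subset {i j : ℤ} {z w : SpaceTime d} (h : cyl i w ⊆ cyl j z)
    (g : SpaceTime d → ℝ≥0∞) : cylAvg i g w ≤ tw ((d + 2) * (j - i)) * cylAvg j g z := by
  rw [cylAvg, cylAvg, ← mul_assoc, ← tw_add]
  refine mul_le_mul' (le_of_eq ?_) (lintegral_mono_set h)
  congr 1; ring

lemma cylAvg_le_of_mem {i j : ℤ} (hij : i ≤ j) {z w : SpaceTime d} (h : w ∈ cyl i z)
    (g : SpaceTime d → ℝ≥0∞) : cylAvg j g w ≤ tw (d + 2) * cylAvg (j + 1) g z := by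
  convert cylAvg_le_of_subset (cyl_subset_cyl hij h) g using 3
  push_cast; ring

/-- Averaging at a fixed scale is self-adjoint, so it can be moved from `g` to `φ`. Cutting `φ` off
to the cylinder of size `2 ^ i` keeps the result local: averages at a scale `j ≤ i` only spread the
support into the next larger cylinder. -/
lemma cylAvg_mul_cylAvg_le {i j : ℤ} (hij : j ≤ i) {φ g : SpaceTime d → ℝ≥0∞}
    (hφ : Measurable φ) (hg : Measurable g) (z : SpaceTime d) :
    cylAvg i (fun w => φ w * cylAvg j g w) z ≤
      tw (d + 2) * cylAvg (i + 1) (fun w => cylAvg j φ w * g w) z := by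
  have h1 : ∫⁻ w in cyl i z, φ w * cylAvg j g w ≤
      ∫⁻ w in cyl (i + 1) z, cylAvg j φ w * g w := by
    rw [← lintegral_indicator (measurableSet_cyl i z),
      ← lintegral_indicator (measurableSet_cyl (i + 1) z)]
    have h2 : ∀ w, (cyl i z).indicator (fun w => φ w * cylAvg j g w) w =
        (cyl i z).indicator φ w * cylAvg j g w := by
      intro w
      by_cases h : w ∈ cyl i z <;> simp [h]
    simp_rw [h2]
    rw [lintegral_mul_cylAvg j hg (hφ.indicator (measurableSet_cyl i z))]
    refine lintegral_mono fun w => ?_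
    by_cases h : w ∈ cyl (i + 1) z
    · rw [Set.indicator_of_mem h]
      gcongr
      exact cylAvg_mono (fun y => Set.indicator_le_self _ _ _) j w
    · rw [Set.indicator_of_notMem h]
      have h3 : cylAvg j ((cyl i z).indicator φ) w ≤ cylAvg j (fun _ => 0) w := by
        refine cylAvg_mono_on j w fun y hy => ?_
        rw [Set.indicator_of_notMem]
        intro hy'
        apply h
        have hw : w ∈ cyl j y := mem_cyl_comm.1 hy
        have hji : (j : ℝ) ≤ i := by exact_mod_cast hij
        refine cyl_subset_cyl le_rfl hy' ?_
        rw [mem_cyl] at hw ⊢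
        exact ⟨hw.1.trans_le (Real.rpow_le_rpow_of_exponent_le one_le_two (by linarith)),
          hw.2.trans_le (Real.rpow_le_rpow_of_exponent_le one_le_two (by linarith))⟩
      have h4 : cylAvg j ((cyl i z).indicator φ) w = 0 := by
        simpa [cylAvg] using h3
      simp [h4]
  rw [cylAvg, cylAvg, ← mul_assoc, ← tw_add]
  refine mul_le_mul' (le_of_eq ?_) h1
  congr 1; push_cast; ring

lemma cylAvg_holder {f g : SpaceTime d → ℝ≥0∞} (hf : Measurable f) (hg : Measurable g)
    {a b : ℝ} (ha : 0 ≤ a) (hb : 0 ≤ b) (hab : a + b = 1) (j : ℤ) (z : SpaceTime d) :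
    cylAvg j (fun w => f w ^ a * g w ^ b) z ≤ cylAvg j f z ^ a * cylAvg j g z ^ b := by
  rw [cylAvg, cylAvg, cylAvg, ENNReal.mul_rpow_of_nonneg _ _ ha, ENNReal.mul_rpow_of_nonneg _ _ hb,
    tw_rpow, tw_rpow]
  have h := ENNReal.lintegral_mul_norm_pow_le (μ := volume.restrict (cyl j z))
    hf.aemeasurable hg.aemeasurable ha hb hab
  calc _ ≤ tw (-((d + 2) * j)) *
        ((∫⁻ w in cyl j z, f w) ^ a * (∫⁻ w in cyl j z, g w) ^ b) := by gcongr
    _ = tw (-((d + 2) * j) * a + -((d + 2) * j) * b) *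
        ((∫⁻ w in cyl j z, f w) ^ a * (∫⁻ w in cyl j z, g w) ^ b) := by
      rw [← mul_add, hab, mul_one]
    _ = _ := by rw [tw_add]; ring

lemma volume_ball_two_rpow (x : EuclideanSpace ℝ (Fin d)) (j : ℝ) :
    volume (Metric.ball x ((2 : ℝ) ^ j)) =
      tw (d * j) * volume (Metric.ball (0 : EuclideanSpace ℝ (Fin d)) 1) := by
  rw [Measure.addHaar_ball_of_pos _ _ (by positivity), finrank_euclideanSpace, Fintype.card_fin,
    ← Real.rpow_natCast, ← Real.rpow_mul two_pos.le, ofReal_two_rpow, mul_comm j]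

lemma setLIntegral_cyl {g : SpaceTime d → ℝ≥0∞} (hg : Measurable g) (j : ℤ) (z : SpaceTime d) :
    ∫⁻ w in cyl j z, g w = ∫⁻ τ in Metric.ball z.1 ((2 : ℝ) ^ (2 * j : ℝ)),
      ∫⁻ y in Metric.ball z.2 ((2 : ℝ) ^ (j : ℝ)), g (τ, y) := by
  rw [cyl, Measure.volume_eq_prod, setLIntegral_prod _ hg.aemeasurable]

/-- The unit ball appears because the averages are normalised by powers of two, not by volumes. -/
lemma cylAvg_time {U : ℝ → ℝ≥0∞} (hU : Measurable U) (j : ℤ) (z : SpaceTime d) :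
    cylAvg j (fun w => U w.1) z =
      volume (Metric.ball (0 : EuclideanSpace ℝ (Fin d)) 1) * timeAvg j U z.1 := by
  rw [cylAvg, setLIntegral_cyl (by fun_prop), timeAvg]
  simp only [setLIntegral_const, volume_ball_two_rpow]
  rw [lintegral_mul_const _ hU]
  have : tw (-(2 * j)) = tw (-((d + 2) * j)) * tw (d * j) := by
    rw [← tw_add]; congr 1; ring
  rw [this]; ring

/-- A bound for the space averages, uniform in time, passes to weighted cylinder averages. -/
lemma cylAvg_mul_time_le {U : ℝ → ℝ≥0∞} (hU : Measurable U) {h : SpaceTime d → ℝ≥0∞}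
    (hh : Measurable h) {D : ℝ≥0∞} {γ : ℝ}
    (hD : ∀ (t : ℝ) (j : ℤ) (x : EuclideanSpace ℝ (Fin d)),
      ∫⁻ y in Metric.ball x ((2 : ℝ) ^ (j : ℝ)), h (t, y) ≤ D * tw ((d - γ) * j))
    (j : ℤ) (z : SpaceTime d) :
    cylAvg j (fun w => h w * U w.1) z ≤ D * (timeAvg j U z.1 * tw (-γ * j)) := by
  rw [cylAvg, setLIntegral_cyl (by fun_prop), timeAvg]
  have h1 : ∀ τ, ∫⁻ y in Metric.ball z.2 ((2 : ℝ) ^ (j : ℝ)), h (τ, y) * U τ ≤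
      D * tw ((d - γ) * j) * U τ := by
    intro τ
    rw [lintegral_mul_const _ (by fun_prop)]
    gcongr
    exact hD τ j z.2
  calc _ ≤ tw (-((d + 2) * j)) * ∫⁻ τ in Metric.ball z.1 ((2 : ℝ) ^ (2 * j : ℝ)),
        D * tw ((d - γ) * j) * U τ := by
        gcongr with τ
        exact h1 τ
    _ = _ := by
      rw [lintegral_const_mul _ hU]
      have : tw (-(2 * j)) * tw (-γ * j) = tw (-((d + 2) * j)) * tw ((d - γ) * j) := by
        rw [← tw_add, ← tw_add]; congr 1; ring
      calc _ = D * (tw (-((d + 2) * j)) * tw ((d - γ) * j)) *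
            ∫⁻ τ in Metric.ball z.1 ((2 : ℝ) ^ (2 * j : ℝ)), U τ := by ring
        _ = _ := by rw [← this]; ring

/-! ### `A₁` weights in time. -/

/-- A Muckenhoupt `A₁` condition over the intervals of radius `4 ^ j`, required at every point. -/
structure IsA1 (L : ℝ≥0∞) (U : ℝ → ℝ≥0∞) : Prop where
  measurable : Measurable U
  timeAvg_le : ∀ (j : ℤ) (t : ℝ), timeAvg j U t ≤ L * U t
  ne_zero : ∀ (j : ℤ) (t : ℝ), timeAvg j U t ≠ 0
  ne_top : ∀ (j : ℤ) (t : ℝ), timeAvg j U t ≠ ⊤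

lemma timeAvg_le_of_mem {i j : ℤ} (hij : i ≤ j) {t τ : ℝ}
    (h : τ ∈ Metric.ball t ((2 : ℝ) ^ (2 * i : ℝ))) (v : ℝ → ℝ≥0∞) :
    timeAvg j v τ ≤ tw 2 * timeAvg (j + 1) v t := by
  have hij' : (i : ℝ) ≤ j := by exact_mod_cast hij
  rw [timeAvg, timeAvg, ← mul_assoc, ← tw_add]
  refine mul_le_mul' (le_of_eq ?_) (lintegral_mono_set ?_)
  · congr 1; push_cast; ring
  · apply ball_subset_ball_two_rpow h (by linarith)
    push_cast; linarith

lemma timeAvg_const (j : ℤ) (c : ℝ≥0∞) (t : ℝ) : timeAvg j (fun _ => c) t = 2 * c := by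
  rw [timeAvg, setLIntegral_const, Real.volume_ball, ENNReal.ofReal_mul two_pos.le,
    ofReal_two_rpow, ENNReal.ofReal_ofNat]
  calc _ = 2 * c * (tw (2 * j) * tw (-(2 * j))) := by ring
    _ = _ := by rw [tw_mul_tw_neg, mul_one]

lemma timeAvg_mono_on {u v : ℝ → ℝ≥0∞} (j : ℤ) (t : ℝ)
    (h : ∀ τ ∈ Metric.ball t ((2 : ℝ) ^ (2 * j : ℝ)), u τ ≤ v τ) :
    timeAvg j u t ≤ timeAvg j v t := by
  unfold timeAvg
  gcongr 1
  exact setLIntegral_mono' Metric.isOpen_ball.measurableSet h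

lemma timeAvg_le_succ (j : ℤ) (v : ℝ → ℝ≥0∞) (t : ℝ) :
    timeAvg j v t ≤ tw 2 * timeAvg (j + 1) v t :=
  timeAvg_le_of_mem le_rfl (Metric.mem_ball_self (by positivity)) v

lemma iUnion_ball_two_rpow (t : ℝ) :
    (⋃ j : ℕ, Metric.ball t ((2 : ℝ) ^ (2 * (j : ℤ) : ℝ))) = Set.univ := by
  apply Set.eq_univ_of_forall
  intro τ
  obtain ⟨n, hn⟩ := pow_unbounded_of_one_lt (dist τ t) (one_lt_two (α := ℝ))
  refine Set.mem_iUnion.2 ⟨n, ?_⟩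
  rw [Metric.mem_ball]
  refine hn.trans_le ?_
  rw [← Real.rpow_natCast]
  apply Real.rpow_le_rpow_of_exponent_le one_le_two
  push_cast
  linarith [Nat.cast_nonneg (α := ℝ) n]

namespace IsA1

variable {L : ℝ≥0∞} {U : ℝ → ℝ≥0∞}

lemma apply_ne_zero (hU : IsA1 L U) (t : ℝ) : U t ≠ 0 := by
  intro h
  have := hU.timeAvg_le 0 t
  rw [h, mul_zero, nonpos_iff_eq_zero] at this
  exact hU.ne_zero 0 t this

lemma timeAvg_le_apply (hU : IsA1 L U) {j : ℤ} {t τ : ℝ}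
    (h : τ ∈ Metric.ball t ((2 : ℝ) ^ (2 * j : ℝ))) : timeAvg j U t ≤ tw 2 * L * U τ := by
  rw [mul_assoc]
  exact (timeAvg_le_of_mem le_rfl (Metric.mem_ball_comm.1 h) U).trans
    (mul_le_mul_right (hU.timeAvg_le _ _) _)

/-- This is the doubling property. The average at scale `j + 1` lies below a multiple of `U` at
every point of the interval about `τ`; averaging this over that interval gives the claim. -/
lemma timeAvg_succ_le (hU : IsA1 L U) {j : ℤ} {t τ : ℝ}
    (h : τ ∈ Metric.ball t ((2 : ℝ) ^ (2 * j : ℝ))) :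
    timeAvg (j + 1) U t ≤ tw 2 * L * timeAvg j U τ := by
  have h1 : timeAvg j (fun _ => timeAvg (j + 1) U t) τ ≤
      timeAvg j (fun τ' => tw 2 * L * U τ') τ := by
    apply timeAvg_mono_on
    intro τ' hτ'
    apply hU.timeAvg_le_apply
    refine ball_subset_ball_two_rpow h le_rfl ?_ hτ'
    push_cast; linarith
  rw [timeAvg_const] at h1
  have h2 : timeAvg j (fun τ' => tw 2 * L * U τ') τ = tw 2 * L * timeAvg j U τ := by
    rw [timeAvg, lintegral_const_mul _ hU.measurable, timeAvg]; ring
  rw [h2] at h1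
  refine le_trans ?_ h1
  rw [two_mul]
  exact le_self_add

lemma ae_lt_top (hU : IsA1 L U) : ∀ᵐ t, U t < ⊤ := by
  have h : ∀ j : ℕ, ∀ᵐ t ∂volume.restrict (Metric.ball (0 : ℝ) ((2 : ℝ) ^ (2 * (j : ℤ) : ℝ))),
      U t < ⊤ := by
    intro j
    apply MeasureTheory.ae_lt_top hU.measurable
    intro h
    apply hU.ne_top j 0
    rw [timeAvg, h, ENNReal.mul_top (tw_ne_zero _)]
  rw [← Measure.restrict_univ (μ := volume), ← iUnion_ball_two_rpow 0]
  exact (ae_restrict_iUnion_iff _ _).2 h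

lemma ae_lt_top_fst (hU : IsA1 L U) : ∀ᵐ z : SpaceTime d, U z.1 < ⊤ := by
  rw [Measure.volume_eq_prod]
  exact Measure.quasiMeasurePreserving_fst.ae hU.ae_lt_top

end IsA1

/-! ### The weighted potential used to build Schur test functions. -/

/-- The volume of the unit ball. -/
def unitVol (d : ℕ) : ℝ≥0∞ := volume (Metric.ball (0 : EuclideanSpace ℝ (Fin d)) 1)

lemma unitVol_ne_top : unitVol d ≠ ⊤ := measure_ball_lt_top.ne

lemma cylAvg_mul_time_bound {U : ℝ → ℝ≥0∞} (hU : Measurable U) (c : ℝ≥0∞) (j : ℤ)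
    (z : SpaceTime d) {φ : SpaceTime d → ℝ≥0∞} (h : ∀ w ∈ cyl j z, φ w ≤ c) :
    cylAvg j (fun w => φ w * U w.1) z ≤ c * unitVol d * timeAvg j U z.1 := by
  rw [mul_assoc, unitVol, ← cylAvg_time hU, ← cylAvg_const_mul (by fun_prop)]
  exact cylAvg_mono_on j z fun w hw => mul_le_mul_left (h w hw) _

/-- A potential of order `ε` of `g`, normalised by the averages of the weight `U`. -/
def weightedPot (ε : ℝ) (U : ℝ → ℝ≥0∞) (g : SpaceTime d → ℝ≥0∞) (z : SpaceTime d) : ℝ≥0∞ :=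
  ∑' j : ℤ, tw (ε * j) * (cylAvg j g z * (timeAvg j U z.1)⁻¹)

lemma measurable_weightedPot_term {U : ℝ → ℝ≥0∞} (hU : Measurable U) {g : SpaceTime d → ℝ≥0∞}
    (hg : Measurable g) (ε : ℝ) (j : ℤ) :
    Measurable fun z : SpaceTime d => tw (ε * j) * (cylAvg j g z * (timeAvg j U z.1)⁻¹) :=
  ((measurable_cylAvg hg j).mul
    ((measurable_timeAvg hU j).comp measurable_fst).inv).const_mul _

lemma measurable_weightedPot {U : ℝ → ℝ≥0∞} (hU : Measurable U) {g : SpaceTime d → ℝ≥0∞}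
    (hg : Measurable g) (ε : ℝ) : Measurable (weightedPot ε U g) :=
  Measurable.tsum (measurable_weightedPot_term hU hg ε)

lemma inv_le_mul_inv {x y c : ℝ≥0∞} (hc : c ≠ ⊤) (hx0 : x ≠ 0) (h : x ≤ c * y) :
    y⁻¹ ≤ c * x⁻¹ := by
  have hc0 : c ≠ 0 := by
    rintro rfl
    simp at h
    exact hx0 h
  have h1 := ENNReal.inv_le_inv.2 h
  rw [ENNReal.mul_inv (Or.inl hc0) (Or.inl hc)] at h1
  calc y⁻¹ = c * (c⁻¹ * y⁻¹) := by rw [← mul_assoc, ENNReal.mul_inv_cancel hc0 hc, one_mul]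
    _ ≤ _ := by gcongr

/-- The averages of a weighted potential see only the large scales. -/
lemma cylAvg_weightedPot_le {ε : ℝ} (hε : 0 < ε) {L : ℝ≥0∞} (hL : L ≠ ⊤) :
    ∃ C : ℝ≥0∞, C ≠ ⊤ ∧ ∀ (U : ℝ → ℝ≥0∞) (g : SpaceTime d → ℝ≥0∞), IsA1 L U → Measurable g →
      ∀ (i : ℤ) (z : SpaceTime d), cylAvg i (fun w => weightedPot ε U g w * U w.1) z ≤
        C * timeAvg i U z.1 * ∑' j : ℤ, if i ≤ j then
          tw (ε * j) * (cylAvg (j + 1) g z * (timeAvg (j + 1) U z.1)⁻¹) else 0 := by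
  obtain ⟨Cg, hCg, hgeo⟩ := tsum_tw_le hε
  set K : ℝ≥0∞ := tw 2 * L with hK
  have hKt : K ≠ ⊤ := ENNReal.mul_ne_top (tw_ne_top _) hL
  set C1 : ℝ≥0∞ := tw (d + 2) * K * unitVol d with hC1
  set C2 : ℝ≥0∞ := tw (d + 2) * (K * unitVol d * tw 2) with hC2
  have hC1t : C1 ≠ ⊤ := ENNReal.mul_ne_top (ENNReal.mul_ne_top (tw_ne_top _) hKt) unitVol_ne_top
  have hC2t : C2 ≠ ⊤ := ENNReal.mul_ne_top (tw_ne_top _)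
    (ENNReal.mul_ne_top (ENNReal.mul_ne_top hKt unitVol_ne_top) (tw_ne_top _))
  refine ⟨C1 + C2 * Cg * K, ENNReal.add_ne_top.2 ⟨hC1t,
    ENNReal.mul_ne_top (ENNReal.mul_ne_top hC2t hCg) hKt⟩, ?_⟩
  intro U g hU hg i z
  have hdoub : ∀ (j : ℤ) (τ : ℝ), τ ∈ Metric.ball z.1 ((2 : ℝ) ^ (2 * j : ℝ)) →
      (timeAvg j U τ)⁻¹ ≤ K * (timeAvg (j + 1) U z.1)⁻¹ := fun j τ hτ =>
    inv_le_mul_inv hKt (hU.ne_zero _ _) (hU.timeAvg_succ_le hτ)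
  set S : ℤ → ℝ≥0∞ := fun j =>
    tw (ε * j) * (cylAvg (j + 1) g z * (timeAvg (j + 1) U z.1)⁻¹) with hS
  -- At scales `j ≥ i` the term is essentially constant on the cylinder of size `2 ^ i`, so it comes
  -- out of the average.
  have hlarge : ∀ j, i ≤ j → cylAvg i (fun w =>
      tw (ε * j) * (cylAvg j g w * (timeAvg j U w.1)⁻¹) * U w.1) z ≤
        C1 * timeAvg i U z.1 * S j := by
    intro j hij
    have hij' : (i : ℝ) ≤ j := by exact_mod_cast hij
    refine (cylAvg_mul_time_bound hU.measurable (tw (d + 2) * K * S j) i z ?_).trans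
      (le_of_eq (by rw [hC1]; ring))
    intro w hw
    have h1 := cylAvg_le_of_mem hij hw g
    have h2 := hdoub j w.1 (Metric.ball_subset_ball
      (Real.rpow_le_rpow_of_exponent_le one_le_two (by linarith)) hw.1)
    calc _ ≤ tw (ε * j) * (tw (d + 2) * cylAvg (j + 1) g z *
          (K * (timeAvg (j + 1) U z.1)⁻¹)) := by gcongr
      _ = _ := by rw [hS]; ring
  -- At scales `j ≤ i` the averaging is moved from `g` onto `U` divided by its own average, and
  -- doubling bounds the result by a constant.
  have hsmall : ∀ j, j ≤ i → cylAvg i (fun w =>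
      tw (ε * j) * (cylAvg j g w * (timeAvg j U w.1)⁻¹) * U w.1) z ≤
        C2 * tw (ε * j) * cylAvg (i + 1) g z := by
    intro j hji
    have hm : Measurable fun w : SpaceTime d => (timeAvg j U w.1)⁻¹ * U w.1 :=
      (((measurable_timeAvg hU.measurable j).comp measurable_fst).inv).mul
        (hU.measurable.comp measurable_fst)
    have e : (fun w : SpaceTime d => tw (ε * j) * (cylAvg j g w * (timeAvg j U w.1)⁻¹) * U w.1) =
        fun w => tw (ε * j) * ((timeAvg j U w.1)⁻¹ * U w.1 * cylAvg j g w) := by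
      ext w; ring
    have hm2 : Measurable fun w : SpaceTime d => (timeAvg j U w.1)⁻¹ * U w.1 * cylAvg j g w :=
      hm.mul (measurable_cylAvg hg j)
    rw [e, cylAvg_const_mul hm2]
    have h1 : ∀ w : SpaceTime d, cylAvg j (fun w => (timeAvg j U w.1)⁻¹ * U w.1) w ≤
        K * unitVol d * tw 2 := by
      intro w
      refine (cylAvg_mul_time_bound hU.measurable (K * (timeAvg (j + 1) U w.1)⁻¹) j w ?_).trans ?_
      · intro y hy
        exact inv_le_mul_inv hKt (hU.ne_zero _ _) (hU.timeAvg_succ_le hy.1)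
      · calc _ ≤ K * (timeAvg (j + 1) U w.1)⁻¹ * unitVol d *
              (tw 2 * timeAvg (j + 1) U w.1) := by gcongr; exact timeAvg_le_succ _ _ _
          _ = K * unitVol d * tw 2 * ((timeAvg (j + 1) U w.1)⁻¹ * timeAvg (j + 1) U w.1) := by
            ring
          _ = _ := by rw [ENNReal.inv_mul_cancel (hU.ne_zero _ _) (hU.ne_top _ _), mul_one]
    calc _ ≤ tw (ε * j) * (tw (d + 2) * cylAvg (i + 1)
          (fun w => cylAvg j (fun w => (timeAvg j U w.1)⁻¹ * U w.1) w * g w) z) := by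
          gcongr; exact cylAvg_mul_cylAvg_le hji hm hg z
      _ ≤ tw (ε * j) * (tw (d + 2) * cylAvg (i + 1) (fun w => K * unitVol d * tw 2 * g w) z) := by
          gcongr
          exact cylAvg_mono (fun w => mul_le_mul_left (h1 w) _) _ _
      _ = _ := by rw [cylAvg_const_mul hg, hC2]; ring
  have e : (fun w : SpaceTime d => weightedPot ε U g w * U w.1) = fun w =>
      ∑' j : ℤ, tw (ε * j) * (cylAvg j g w * (timeAvg j U w.1)⁻¹) * U w.1 := by
    ext w; rw [weightedPot, ENNReal.tsum_mul_right]
  have hm : ∀ j : ℤ, Measurable fun w : SpaceTime d =>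
      tw (ε * j) * (cylAvg j g w * (timeAvg j U w.1)⁻¹) * U w.1 := fun j =>
    (measurable_weightedPot_term hU.measurable hg ε j).mul (hU.measurable.comp measurable_fst)
  rw [e, cylAvg_tsum hm]
  have hterm : ∀ j : ℤ, cylAvg i (fun w =>
      tw (ε * j) * (cylAvg j g w * (timeAvg j U w.1)⁻¹) * U w.1) z ≤
        C1 * timeAvg i U z.1 * (if i ≤ j then S j else 0) +
          C2 * cylAvg (i + 1) g z * (if j ≤ i then tw (ε * j) else 0) := by
    intro j
    rcases le_total i j with h | h
    · rw [if_pos h]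
      exact (hlarge j h).trans le_self_add
    · rw [if_pos h]
      refine (hsmall j h).trans (le_trans (le_of_eq ?_) le_add_self)
      ring
  refine (ENNReal.tsum_le_tsum hterm).trans ?_
  rw [ENNReal.tsum_add, ENNReal.tsum_mul_left, ENNReal.tsum_mul_left, add_mul, add_mul]
  refine add_le_add le_rfl ?_
  -- The factors `2 ^ (ε j)` of the small scales sum to a multiple of `2 ^ (ε i)`, so together these
  -- scales cost no more than the single term `S i`.
  have hsingle : S i ≤ ∑' j : ℤ, if i ≤ j then S j else 0 := by
    refine le_trans (le_of_eq ?_) (ENNReal.le_tsum i)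
    simp
  calc _ ≤ C2 * cylAvg (i + 1) g z * (Cg * tw (ε * i)) := by gcongr; exact hgeo i
    _ = C2 * Cg * (tw (ε * i) * (cylAvg (i + 1) g z * (timeAvg (i + 1) U z.1)⁻¹)) *
        timeAvg (i + 1) U z.1 := by
      have := ENNReal.inv_mul_cancel (hU.ne_zero (i + 1) z.1) (hU.ne_top (i + 1) z.1)
      calc _ = C2 * cylAvg (i + 1) g z * (Cg * tw (ε * i)) *
            ((timeAvg (i + 1) U z.1)⁻¹ * timeAvg (i + 1) U z.1) := by rw [this, mul_one]
        _ = _ := by ring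
    _ ≤ C2 * Cg * S i * (K * timeAvg i U z.1) := by
      gcongr
      exact hU.timeAvg_succ_le (Metric.mem_ball_self (by positivity))
    _ ≤ C2 * Cg * (∑' j : ℤ, if i ≤ j then S j else 0) * (K * timeAvg i U z.1) := by gcongr
    _ = _ := by ring

/-! ### The dyadic Riesz potential. -/

/-- A dyadic parabolic Riesz kernel of order `α`. -/
def rieszKer (α : ℝ) (z w : SpaceTime d) : ℝ≥0∞ :=
  ∑' j : ℤ, (cyl j z).indicator (fun _ => tw (α * j) * tw (-((d + 2) * j))) w

/-- The potential with kernel `rieszKer`. -/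
def rieszPot (α : ℝ) (g : SpaceTime d → ℝ≥0∞) (z : SpaceTime d) : ℝ≥0∞ :=
  ∫⁻ w, rieszKer α z w * g w

lemma measurable_rieszKer (α : ℝ) :
    Measurable fun p : SpaceTime d × SpaceTime d => rieszKer α p.1 p.2 :=
  Measurable.tsum fun j => measurable_indicator_cyl j _

lemma rieszKer_symm (α : ℝ) (z w : SpaceTime d) : rieszKer α z w = rieszKer α w z :=
  tsum_congr fun j => indicator_cyl_symm j _ z w

lemma measurable_rieszPot (α : ℝ) {g : SpaceTime d → ℝ≥0∞} (hg : Measurable g) :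
    Measurable (rieszPot α g) :=
  ((measurable_rieszKer α).mul (hg.comp measurable_snd)).lintegral_prod_right'

lemma rieszPot_eq_tsum (α : ℝ) {g : SpaceTime d → ℝ≥0∞} (hg : Measurable g) (z : SpaceTime d) :
    rieszPot α g z = ∑' j : ℤ, tw (α * j) * cylAvg j g z := by
  simp_rw [rieszPot, rieszKer, ← ENNReal.tsum_mul_right]
  rw [lintegral_tsum]
  · refine tsum_congr fun j => ?_
    rw [cylAvg_eq_lintegral, ← lintegral_const_mul' _ _ (tw_ne_top _)]
    refine lintegral_congr fun w => ?_
    by_cases h : w ∈ cyl j z <;> simp [h, mul_assoc]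
  · intro j
    exact (((measurable_indicator_cyl j _).comp measurable_prodMk_left).mul hg).aemeasurable

lemma lintegral_mul_rieszPot (α : ℝ) {g h : SpaceTime d → ℝ≥0∞} (hg : Measurable g)
    (hh : Measurable h) : ∫⁻ z, h z * rieszPot α g z = ∫⁻ z, rieszPot α h z * g z :=
  lintegral_symm_kernel (measurable_rieszKer α) (rieszKer_symm α) hg hh

/-! ### Scale bounds and their summation. -/

/-- Weighted averages of `φ` over all cylinders are controlled by `Ω` at the centre, and decay
with the size of the cylinder. -/
def ScaleBound (C : ℝ≥0∞) (ε θ δ : ℝ) (U : ℝ → ℝ≥0∞) (Ω φ : SpaceTime d → ℝ≥0∞) : Prop :=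
  ∀ (i : ℤ) (z : SpaceTime d), cylAvg i (fun w => φ w * U w.1) z ≤
    C * (timeAvg i U z.1 * min (tw (-ε * i) * Ω z ^ θ) (tw (-(ε + δ * θ) * i)))

/-- Uniform bound for the integrals of `h` over balls in each time slice. -/
def SliceBound (γ : ℝ) (D : ℝ≥0∞) (h : SpaceTime d → ℝ≥0∞) : Prop :=
  ∀ (t : ℝ) (j : ℤ) (x : EuclideanSpace ℝ (Fin d)),
    ∫⁻ y in Metric.ball x ((2 : ℝ) ^ (j : ℝ)), h (t, y) ≤ D * tw ((d - γ) * j)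

lemma mul_rpow_add {x : ℝ≥0∞} {a b : ℝ} (ha : 0 ≤ a) (hb : 0 ≤ b) (hab : a + b = 1) :
    x ^ a * x ^ b = x := by
  rw [← ENNReal.rpow_add_of_nonneg _ _ ha hb, hab, ENNReal.rpow_one]

/-- Write the integrand as `(φ₁ U) ^ a (φ₂ U) ^ b` and apply Hölder on each cylinder. In both
branches of the minimum the exponents are linear in `(ε, θ)`, so they interpolate. -/
lemma ScaleBound.holder {C₁ C₂ : ℝ≥0∞} {ε₁ ε₂ θ₁ θ₂ δ : ℝ} {U : ℝ → ℝ≥0∞}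
    {Ω φ₁ φ₂ : SpaceTime d → ℝ≥0∞} (h₁ : ScaleBound C₁ ε₁ θ₁ δ U Ω φ₁)
    (h₂ : ScaleBound C₂ ε₂ θ₂ δ U Ω φ₂) (hU : Measurable U) (hφ₁ : Measurable φ₁)
    (hφ₂ : Measurable φ₂) {a b : ℝ} (ha : 0 ≤ a) (hb : 0 ≤ b) (hab : a + b = 1)
    (hθ₁ : 0 ≤ θ₁) (hθ₂ : 0 ≤ θ₂) :
    ScaleBound (C₁ ^ a * C₂ ^ b) (a * ε₁ + b * ε₂) (a * θ₁ + b * θ₂) δ U Ω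
      (fun w => φ₁ w ^ a * φ₂ w ^ b) := by
  intro i z
  have e : (fun w : SpaceTime d => φ₁ w ^ a * φ₂ w ^ b * U w.1) =
      fun w => (φ₁ w * U w.1) ^ a * (φ₂ w * U w.1) ^ b := by
    ext w
    rw [ENNReal.mul_rpow_of_nonneg _ _ ha, ENNReal.mul_rpow_of_nonneg _ _ hb]
    nth_rewrite 1 [← mul_rpow_add (x := U w.1) ha hb hab]
    ring
  rw [e]
  refine (cylAvg_holder (by fun_prop) (by fun_prop) ha hb hab i z).trans ?_
  set u := timeAvg i U z.1
  calc _ ≤ (C₁ * (u * min (tw (-ε₁ * i) * Ω z ^ θ₁) (tw (-(ε₁ + δ * θ₁) * i)))) ^ a *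
        (C₂ * (u * min (tw (-ε₂ * i) * Ω z ^ θ₂) (tw (-(ε₂ + δ * θ₂) * i)))) ^ b := by
        gcongr
        · exact h₁ i z
        · exact h₂ i z
    _ = C₁ ^ a * C₂ ^ b * (u * (min (tw (-ε₁ * i) * Ω z ^ θ₁) (tw (-(ε₁ + δ * θ₁) * i)) ^ a *
        min (tw (-ε₂ * i) * Ω z ^ θ₂) (tw (-(ε₂ + δ * θ₂) * i)) ^ b)) := by
      rw [ENNReal.mul_rpow_of_nonneg _ _ ha, ENNReal.mul_rpow_of_nonneg _ _ ha,
        ENNReal.mul_rpow_of_nonneg _ _ hb, ENNReal.mul_rpow_of_nonneg _ _ hb]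
      nth_rewrite 3 [← mul_rpow_add (x := u) ha hb hab]
      ring
    _ ≤ _ := by
      gcongr
      apply le_min
      · calc _ ≤ (tw (-ε₁ * i) * Ω z ^ θ₁) ^ a * (tw (-ε₂ * i) * Ω z ^ θ₂) ^ b := by
              gcongr <;> exact min_le_left _ _
          _ = tw (-ε₁ * i * a + -ε₂ * i * b) * (Ω z ^ (θ₁ * a) * Ω z ^ (θ₂ * b)) := by
            rw [ENNReal.mul_rpow_of_nonneg _ _ ha, ENNReal.mul_rpow_of_nonneg _ _ hb, tw_rpow,
              tw_rpow, ← ENNReal.rpow_mul, ← ENNReal.rpow_mul, tw_add]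
            ring
          _ = _ := by
            rw [← ENNReal.rpow_add_of_nonneg _ _ (by positivity) (by positivity)]
            congr 2 <;> ring
      · calc _ ≤ (tw (-(ε₁ + δ * θ₁) * i)) ^ a * (tw (-(ε₂ + δ * θ₂) * i)) ^ b := by
              gcongr <;> exact min_le_right _ _
          _ = _ := by
            rw [tw_rpow, tw_rpow, ← tw_add]
            congr 1; ring

/-- The trivial endpoint: interpolating `Ω` with it gives bounds for the powers `Ω ^ x`, `0 ≤ x ≤
1`. -/
lemma scaleBound_one {U : ℝ → ℝ≥0∞} (hU : Measurable U) (δ : ℝ) (Ω : SpaceTime d → ℝ≥0∞) :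
    ScaleBound (unitVol d) 0 0 δ U Ω (fun _ => 1) := by
  intro i z
  simp [cylAvg_time hU, unitVol, tw_zero]

/-- The first branch holds because the average at scale `i` is one term of the series for `Ω`; the
second is the slice bound. -/
lemma SliceBound.scaleBound {γ ε δ : ℝ} (hγ : γ = ε + δ) {D : ℝ≥0∞} {h : SpaceTime d → ℝ≥0∞}
    (hh : Measurable h) (hD : SliceBound γ D h) {L : ℝ≥0∞} {U : ℝ → ℝ≥0∞} (hU : IsA1 L U) :
    ScaleBound (D + 1) ε 1 δ U (weightedPot ε U fun w => h w * U w.1) h := by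
  intro i z
  set g : SpaceTime d → ℝ≥0∞ := fun w => h w * U w.1
  rw [ENNReal.rpow_one, mul_one, mul_min, mul_min]
  apply le_min
  · have h1 : tw (ε * i) * (cylAvg i g z * (timeAvg i U z.1)⁻¹) ≤ weightedPot ε U g z :=
      ENNReal.le_tsum (f := fun i : ℤ => tw (ε * i) * (cylAvg i g z * (timeAvg i U z.1)⁻¹)) i
    calc cylAvg i g z = tw (ε * i) * tw (-(ε * i)) * cylAvg i g z *
          ((timeAvg i U z.1)⁻¹ * timeAvg i U z.1) := by
          rw [tw_mul_tw_neg, ENNReal.inv_mul_cancel (hU.ne_zero _ _) (hU.ne_top _ _)]; simp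
      _ = timeAvg i U z.1 * (tw (-(ε * i)) *
          (tw (ε * i) * (cylAvg i g z * (timeAvg i U z.1)⁻¹))) := by ring
      _ ≤ 1 * (timeAvg i U z.1 * (tw (-ε * i) * weightedPot ε U g z)) := by
        rw [one_mul, neg_mul]
        gcongr
      _ ≤ _ := by gcongr; exact le_add_self
  · refine (cylAvg_mul_time_le hU.measurable hh hD i z).trans ?_
    rw [hγ]
    gcongr
    exact le_self_add

/-- By `cylAvg_weightedPot_le` the average of `Ω U` at scale `i` is controlled by the terms of `Ω`
at scales above `i`. That tail is at most a multiple of `Ω`, and the slice bound makes its terms at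
most a multiple of `2 ^ (-δ j)`, hence summable. -/
lemma scaleBound_weightedPot {γ ε δ : ℝ} (hγ : γ = ε + δ) (hε : 0 < ε) (hδ : 0 < δ)
    {D L : ℝ≥0∞} (hD : D ≠ ⊤) (hL : L ≠ ⊤) :
    ∃ C : ℝ≥0∞, C ≠ ⊤ ∧ ∀ (U : ℝ → ℝ≥0∞) (h : SpaceTime d → ℝ≥0∞), IsA1 L U → Measurable h →
      SliceBound γ D h →
        ScaleBound C 0 1 δ U (weightedPot ε U fun w => h w * U w.1)
          (weightedPot ε U fun w => h w * U w.1) := by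
  obtain ⟨C, hC, hkey⟩ := cylAvg_weightedPot_le (d := d) hε hL
  obtain ⟨Cg, hCg, hgeo⟩ := tsum_tw_ge hδ
  refine ⟨C * (tw (-ε) + D * tw (-γ) * Cg), ENNReal.mul_ne_top hC (ENNReal.add_ne_top.2
    ⟨tw_ne_top _, ENNReal.mul_ne_top (ENNReal.mul_ne_top hD (tw_ne_top _)) hCg⟩), ?_⟩
  intro U h hU hh hs i z
  set g : SpaceTime d → ℝ≥0∞ := fun w => h w * U w.1 with hg
  have hgm : Measurable g := hh.mul (hU.measurable.comp measurable_fst)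
  refine (hkey U g hU hgm i z).trans ?_
  rw [mul_assoc, mul_assoc, ENNReal.rpow_one, mul_left_comm (tw (-ε) + _)]
  gcongr C * (timeAvg i U z.1 * ?_)
  rw [mul_min, neg_zero, zero_mul, tw_zero, one_mul, mul_one, zero_add]
  apply le_min
  · calc _ ≤ ∑' j : ℤ, tw (-ε) * (tw (ε * (j + 1 : ℤ)) *
          (cylAvg (j + 1) g z * (timeAvg (j + 1) U z.1)⁻¹)) := by
          refine ENNReal.tsum_le_tsum fun j => ?_
          split_ifs
          · rw [← mul_assoc (tw (-ε)), ← tw_add]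
            apply le_of_eq
            congr 2
            push_cast; ring
          · exact zero_le
      _ = tw (-ε) * weightedPot ε U g z := by
        rw [ENNReal.tsum_mul_left, weightedPot]
        congr 1
        exact (Equiv.addRight (1 : ℤ)).tsum_eq
          (fun j : ℤ => tw (ε * j) * (cylAvg j g z * (timeAvg j U z.1)⁻¹))
      _ ≤ _ := by gcongr; exact le_self_add
  · calc _ ≤ ∑' j : ℤ, D * tw (-γ) * (if i ≤ j then tw (-δ * j) else 0) := by
          refine ENNReal.tsum_le_tsum fun j => ?_
          split_ifs
          · have h1 := cylAvg_mul_time_le hU.measurable hh hs (j + 1) z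
            calc _ ≤ tw (ε * j) * (D * (timeAvg (j + 1) U z.1 * tw (-γ * (j + 1 : ℤ))) *
                  (timeAvg (j + 1) U z.1)⁻¹) := by gcongr
              _ = D * (tw (ε * j) * tw (-γ * (j + 1 : ℤ))) *
                  (timeAvg (j + 1) U z.1 * (timeAvg (j + 1) U z.1)⁻¹) := by ring
              _ = D * (tw (-γ) * tw (-δ * j)) := by
                rw [ENNReal.mul_inv_cancel (hU.ne_zero _ _) (hU.ne_top _ _), mul_one, ← tw_add,
                  ← tw_add]
                congr 2
                rw [hγ]; push_cast; ring
              _ ≤ _ := by rw [mul_assoc]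
          · exact zero_le
      _ ≤ D * tw (-γ) * (Cg * tw (-δ * i)) := by
        rw [ENNReal.tsum_mul_left]; gcongr; exact hgeo i
      _ = D * tw (-γ) * Cg * tw (-δ * i) := by ring
      _ ≤ _ := by gcongr; exact le_add_self

/-- The condition `ε < α` sums the small scales and `α < ε + δ θ` the large ones. The weighted and
unweighted conclusions serve as the two Schur conditions. -/
lemma ScaleBound.rieszPot_le {α ε θ δ : ℝ} (hδ : 0 < δ) (hε : ε < α) (hη : α < ε + δ * θ)
    {C L : ℝ≥0∞} (hC : C ≠ ⊤) (hL : L ≠ ⊤) :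
    ∃ C' : ℝ≥0∞, C' ≠ ⊤ ∧ ∀ (U : ℝ → ℝ≥0∞) (Ω φ : SpaceTime d → ℝ≥0∞), IsA1 L U →
      Measurable φ → ScaleBound C ε θ δ U Ω φ → ∀ z,
        rieszPot α (fun w => φ w * U w.1) z ≤ C' * (Ω z ^ ((ε + δ * θ - α) / δ) * U z.1) ∧
        rieszPot α φ z ≤ C' * Ω z ^ ((ε + δ * θ - α) / δ) := by
  obtain ⟨Cs, hCs, hsum⟩ := tsum_tw_min hδ hε hη
  set K : ℝ≥0∞ := L + tw 2 * L with hK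
  have hKt : K ≠ ⊤ := ENNReal.add_ne_top.2 ⟨hL, ENNReal.mul_ne_top (tw_ne_top _) hL⟩
  refine ⟨C * K * Cs, ENNReal.mul_ne_top (ENNReal.mul_ne_top hC hKt) hCs, ?_⟩
  intro U Ω φ hU hφ h z
  set m : ℤ → ℝ≥0∞ := fun i => min (tw (-ε * i) * Ω z ^ θ) (tw (-(ε + δ * θ) * i)) with hm
  constructor
  · have hm : Measurable fun w : SpaceTime d => φ w * U w.1 :=
      hφ.mul (hU.measurable.comp measurable_fst)
    rw [rieszPot_eq_tsum α hm]
    calc _ ≤ ∑' i : ℤ, C * K * U z.1 * (tw (α * i) * m i) := by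
          refine ENNReal.tsum_le_tsum fun i => ?_
          calc _ ≤ tw (α * i) * (C * ((K * U z.1) * m i)) := by
                gcongr
                refine (h i z).trans ?_
                gcongr
                refine (hU.timeAvg_le i z.1).trans ?_
                gcongr
                exact le_self_add
            _ = _ := by ring
      _ ≤ C * K * U z.1 * (Cs * Ω z ^ ((ε + δ * θ - α) / δ)) := by
        rw [ENNReal.tsum_mul_left]; gcongr; exact hsum _
      _ = _ := by ring
  · rw [rieszPot_eq_tsum α hφ]
    calc _ ≤ ∑' i : ℤ, C * K * (tw (α * i) * m i) := by
          refine ENNReal.tsum_le_tsum fun i => ?_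
          -- On the cylinder `U` is bounded below by a multiple of its average, since the `A₁`
          -- condition holds at every point; this average is positive and finite and cancels.
          have h1 : cylAvg i φ z * timeAvg i U z.1 ≤ K * (C * m i) * timeAvg i U z.1 := by
            rw [mul_comm, ← cylAvg_const_mul hφ]
            calc _ ≤ cylAvg i (fun w => K * (φ w * U w.1)) z := by
                  refine cylAvg_mono_on i z fun w hw => ?_
                  rw [mul_comm, mul_left_comm]
                  gcongr
                  refine (hU.timeAvg_le_apply hw.1).trans ?_
                  gcongr
                  exact le_add_self
              _ = K * cylAvg i (fun w => φ w * U w.1) z :=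
                cylAvg_const_mul (hφ.mul (hU.measurable.comp measurable_fst)) _ _ _
              _ ≤ K * (C * (timeAvg i U z.1 * m i)) := by gcongr; exact h i z
              _ = _ := by ring
          have h2 := (ENNReal.mul_le_mul_iff_left (hU.ne_zero i z.1) (hU.ne_top i z.1)).1 h1
          calc _ ≤ tw (α * i) * (K * (C * m i)) := by gcongr
            _ = _ := by ring
      _ ≤ C * K * (Cs * Ω z ^ ((ε + δ * θ - α) / δ)) := by
        rw [ENNReal.tsum_mul_left]; gcongr; exact hsum _
      _ = _ := by ring

lemma rieszPot_mono {α : ℝ} {g h : SpaceTime d → ℝ≥0∞} (hgh : ∀ z, g z ≤ h z) (z : SpaceTime d) :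
    rieszPot α g z ≤ rieszPot α h z := by
  unfold rieszPot
  gcongr
  exact hgh _

/-! ### The Schur test. -/

lemma rpow_mul_rpow_neg_le_one (x : ℝ≥0∞) {y : ℝ} (hy : 0 < y) : x ^ (-y) * x ^ y ≤ 1 := by
  rcases eq_or_ne x 0 with rfl | h0
  · simp [ENNReal.zero_rpow_of_pos hy]
  rcases eq_or_ne x ⊤ with rfl | ht
  · simp [ENNReal.top_rpow_of_neg (neg_lt_zero.2 hy)]
  rw [← ENNReal.rpow_add _ _ h0 ht]
  simp

lemma measurable_rieszKer_right (α : ℝ) (z : SpaceTime d) : Measurable (rieszKer α z) :=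
  Measurable.tsum fun j => (measurable_indicator_cyl j _).comp measurable_prodMk_left

/-- Hölder for the measure with density `rieszKer α z`, after splitting `f = (f H ^ (-(p-1)/p)) H ^
((p-1)/p)`; this needs `0 < H < ⊤` almost everywhere. -/
lemma rieszPot_rpow_le (α : ℝ) {p : ℝ} (hp : 1 < p) {f H : SpaceTime d → ℝ≥0∞}
    (hf : Measurable f) (hH : Measurable H) (hH0 : ∀ᵐ z, H z ≠ 0) (hHt : ∀ᵐ z, H z ≠ ⊤)
    (z : SpaceTime d) :
    rieszPot α f z ^ p ≤
      rieszPot α H z ^ (p - 1) * rieszPot α (fun w => f w ^ p * H w ^ (1 - p)) z := by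
  have hp0 : 0 < p := by linarith
  have hκ := measurable_rieszKer_right α z
  have ha : 0 ≤ 1 / p := by positivity
  have hb : 0 ≤ 1 - 1 / p := by
    rw [sub_nonneg, div_le_one hp0]; exact hp.le
  have h1 : rieszPot α f z = ∫⁻ w, (rieszKer α z w * (f w ^ p * H w ^ (1 - p))) ^ (1 / p) *
      (rieszKer α z w * H w) ^ (1 - 1 / p) := by
    refine lintegral_congr_ae ?_
    filter_upwards [hH0, hHt] with w h0 ht
    rw [ENNReal.mul_rpow_of_nonneg _ _ ha, ENNReal.mul_rpow_of_nonneg _ _ ha,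
      ENNReal.mul_rpow_of_nonneg _ _ hb, ← ENNReal.rpow_mul, mul_one_div_cancel hp0.ne',
      ENNReal.rpow_one, ← ENNReal.rpow_mul]
    have e1 : H w ^ ((1 - p) * (1 / p)) * H w ^ (1 - 1 / p) = 1 := by
      rw [← ENNReal.rpow_add _ _ h0 ht]
      have : (1 - p) * (1 / p) + (1 - 1 / p) = 0 := by field_simp; ring
      rw [this, ENNReal.rpow_zero]
    have e2 := mul_rpow_add (x := rieszKer α z w) ha hb (by ring)
    calc _ = (rieszKer α z w ^ (1 / p) * rieszKer α z w ^ (1 - 1 / p)) * f w *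
          (H w ^ ((1 - p) * (1 / p)) * H w ^ (1 - 1 / p)) := by rw [e1, e2, mul_one]
      _ = _ := by ring
  have h2 : rieszPot α f z ≤ rieszPot α (fun w => f w ^ p * H w ^ (1 - p)) z ^ (1 / p) *
      rieszPot α H z ^ (1 - 1 / p) := by
    have hm1 : AEMeasurable fun w => rieszKer α z w * (f w ^ p * H w ^ (1 - p)) :=
      (hκ.mul ((hf.pow_const p).mul (hH.pow_const (1 - p)))).aemeasurable
    have hm2 : AEMeasurable fun w => rieszKer α z w * H w := (hκ.mul hH).aemeasurable
    have h3 := ENNReal.lintegral_mul_norm_pow_le hm1 hm2 ha hb (by ring)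
    rw [h1]
    exact h3
  calc _ ≤ (rieszPot α (fun w => f w ^ p * H w ^ (1 - p)) z ^ (1 / p) *
      rieszPot α H z ^ (1 - 1 / p)) ^ p := by gcongr
    _ = _ := by
      rw [ENNReal.mul_rpow_of_nonneg _ _ hp0.le, ← ENNReal.rpow_mul, ← ENNReal.rpow_mul,
        one_div_mul_cancel hp0.ne', ENNReal.rpow_one, mul_comm]
      congr 2
      field_simp

/-- A Schur test for weighted bounds of `b * rieszPot α f`. -/
lemma schur_test {α p : ℝ} (hp : 1 < p) {b f H V W : SpaceTime d → ℝ≥0∞}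
    (hb : Measurable b) (hf : Measurable f) (hH : Measurable H) (hV : Measurable V)
    (hW : Measurable W) (hH0 : ∀ᵐ z, H z ≠ 0) (hHt : ∀ᵐ z, H z ≠ ⊤) {C₁ C₂ : ℝ≥0∞}
    (h₁ : ∀ z, rieszPot α H z ≤ C₁ * W z)
    (h₂ : ∀ᵐ z, rieszPot α (fun w => V w * b w ^ p * W w ^ (p - 1)) z ≤
      C₂ * (V z * H z ^ (p - 1))) :
    ∫⁻ z, V z * (b z * rieszPot α f z) ^ p ≤ C₁ ^ (p - 1) * C₂ * ∫⁻ z, V z * f z ^ p := by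
  have hp0 : 0 < p := by linarith
  have hp1 : 0 < p - 1 := by linarith
  set F : SpaceTime d → ℝ≥0∞ := fun w => f w ^ p * H w ^ (1 - p) with hF
  have hFm : Measurable F := by fun_prop
  have hGm : Measurable fun w => V w * b w ^ p * W w ^ (p - 1) := by fun_prop
  calc _ ≤ ∫⁻ z, C₁ ^ (p - 1) * (V z * b z ^ p * W z ^ (p - 1) * rieszPot α F z) := by
        refine lintegral_mono fun z => ?_
        rw [ENNReal.mul_rpow_of_nonneg _ _ hp0.le]
        calc _ ≤ V z * (b z ^ p * ((C₁ * W z) ^ (p - 1) * rieszPot α F z)) := by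
              gcongr
              refine (rieszPot_rpow_le α hp hf hH hH0 hHt z).trans ?_
              gcongr
              exact h₁ z
          _ = _ := by
            rw [ENNReal.mul_rpow_of_nonneg _ _ hp1.le]; ring
    _ = C₁ ^ (p - 1) * ∫⁻ z, rieszPot α (fun w => V w * b w ^ p * W w ^ (p - 1)) z * F z := by
        have hm : Measurable fun z => V z * b z ^ p * W z ^ (p - 1) * rieszPot α F z :=
          hGm.mul (measurable_rieszPot α hFm)
        rw [lintegral_const_mul _ hm, lintegral_mul_rieszPot α hFm hGm]
    _ ≤ C₁ ^ (p - 1) * ∫⁻ z, C₂ * (V z * f z ^ p) := by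
        gcongr 1
        refine lintegral_mono_ae ?_
        filter_upwards [h₂] with z hz
        calc _ ≤ C₂ * (V z * H z ^ (p - 1)) * F z := by gcongr
          _ = C₂ * (V z * f z ^ p) * (H z ^ (-(p - 1)) * H z ^ (p - 1)) := by
            rw [hF, neg_sub]; ring
          _ ≤ C₂ * (V z * f z ^ p) * 1 := by
            gcongr; exact rpow_mul_rpow_neg_le_one _ hp1
          _ = _ := mul_one _
    _ = _ := by
        rw [lintegral_const_mul _ (by fun_prop), mul_assoc]

/-! ### Choice of exponents and the weighted estimate. -/

/-- The test function is `Ω ^ a`, and `α / δ < a` makes its potential at most a multiple of `Ω ^ (a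
- α / δ)`, whose power `p - 1` is `Ω ^ s`. The number `κ` writes `b ^ p Ω ^ s` as `(b ^ q) ^ (p / q)
(Ω ^ κ) ^ (1 - p / q)`, and `ε p / q < α` sums its small scales. -/
lemma exists_exponents {α p q : ℝ} (hα : 0 < α) (hp : 1 < p) (hpq : p < q) :
    ∃ ε δ a s κ : ℝ, 0 < ε ∧ α * q = ε + δ ∧ α < δ ∧ ε * (p / q) < α ∧ α / δ < a ∧ a ≤ 1 ∧
      0 < s ∧ s = (a - α / δ) * (p - 1) ∧ 0 ≤ κ ∧ κ ≤ 1 ∧ κ * (1 - p / q) = s := by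
  have hq : 0 < q := by linarith
  have hp1 : 0 < p - 1 := by linarith
  -- The entry 1 gives `ε ≤ α`, hence `ε p / q < α`; the other entry gives `δ = α q - ε > α`.
  set ε := α * min 1 ((q - 1) / 2) with hε
  have h0 : 0 < min 1 ((q - 1) / 2) := lt_min one_pos (by linarith)
  have hεp : 0 < ε := mul_pos hα h0
  have h1 : ε ≤ α := by nlinarith [min_le_left 1 ((q - 1) / 2)]
  have h2 : ε ≤ α * ((q - 1) / 2) := mul_le_mul_of_nonneg_left (min_le_right _ _) hα.le
  have hpq' : p / q < 1 := (div_lt_one hq).2 hpq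
  have hδ : α < α * q - ε := by nlinarith
  have hδ0 : 0 < α * q - ε := hα.trans hδ
  have hαδ : α / (α * q - ε) < 1 := (div_lt_one hδ0).2 hδ
  -- Here `a' = a - α / δ`: the first entry ensures `a ≤ 1`, the second `s ≤ 1 - p / q`, that is `κ
  -- ≤ 1`.
  set a' := min (1 - α / (α * q - ε)) ((1 - p / q) / (p - 1)) with ha'
  have ha'0 : 0 < a' := lt_min (by linarith) (div_pos (by linarith) hp1)
  have ha'1 : a' ≤ 1 - α / (α * q - ε) := min_le_left _ _
  have ha'2 : a' * (p - 1) ≤ 1 - p / q := by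
    rw [← le_div_iff₀ hp1]; exact min_le_right _ _
  refine ⟨ε, α * q - ε, α / (α * q - ε) + a', a' * (p - 1), a' * (p - 1) / (1 - p / q), hεp,
    by ring, hδ, ?_, by linarith, by linarith, mul_pos ha'0 hp1, by ring, ?_, ?_, ?_⟩
  · have : 0 < p / q := by positivity
    nlinarith
  · exact div_nonneg (mul_pos ha'0 hp1).le (by linarith)
  · exact (div_le_one (by linarith)).2 ha'2
  · exact div_mul_cancel₀ _ (by linarith)

lemma iUnion_cyl (z : SpaceTime d) : (⋃ j : ℕ, cyl (j : ℤ) z) = Set.univ := by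
  apply Set.eq_univ_of_forall
  intro w
  obtain ⟨n, hn⟩ := pow_unbounded_of_one_lt (max (dist w.1 z.1) (dist w.2 z.2))
    (one_lt_two (α := ℝ))
  refine Set.mem_iUnion.2 ⟨n, ?_⟩
  rw [← Real.rpow_natCast] at hn
  rw [mem_cyl]
  refine ⟨(le_max_left _ _).trans_lt (hn.trans_le ?_),
    (le_max_right _ _).trans_lt (hn.trans_le ?_)⟩
  · apply Real.rpow_le_rpow_of_exponent_le one_le_two
    push_cast
    linarith [Nat.cast_nonneg (α := ℝ) n]
  · simp

/-- The second branch of the minimum does not involve `Ω`, so `Ω U` is integrable over every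
cylinder about the origin; and `U` never vanishes. -/
lemma ae_lt_top_of_scaleBound {C : ℝ≥0∞} (hC : C ≠ ⊤) {δ : ℝ} {L : ℝ≥0∞} {U : ℝ → ℝ≥0∞}
    (hU : IsA1 L U) {Ω : SpaceTime d → ℝ≥0∞} (hΩ : Measurable Ω)
    (h : ScaleBound C 0 1 δ U Ω Ω) : ∀ᵐ z, Ω z < ⊤ := by
  have h1 : ∀ j : ℕ, ∀ᵐ z ∂volume.restrict (cyl (j : ℤ) (0 : SpaceTime d)), Ω z * U z.1 < ⊤ := by
    intro j
    apply MeasureTheory.ae_lt_top (hΩ.mul (hU.measurable.comp measurable_fst))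
    intro ht
    have h2 := h j 0
    rw [cylAvg] at h2
    change ∫⁻ z in cyl (j : ℤ) (0 : SpaceTime d), Ω z * U z.1 = ⊤ at ht
    rw [ht, ENNReal.mul_top (tw_ne_zero _), top_le_iff] at h2
    refine ENNReal.mul_ne_top hC (ENNReal.mul_ne_top (hU.ne_top _ _) ?_) h2
    exact ne_top_of_le_ne_top (tw_ne_top _) (min_le_right _ _)
  have h4 : ∀ᵐ z, Ω z * U z.1 < ⊤ := by
    rw [← Measure.restrict_univ (μ := volume), ← iUnion_cyl 0]
    exact (ae_restrict_iUnion_iff _ _).2 h1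
  filter_upwards [h4] with z hz
  by_contra! hz'
  rw [top_le_iff] at hz'
  rw [hz', ENNReal.top_mul (hU.apply_ne_zero _)] at hz
  exact lt_irrefl _ hz

/-- One zero of the potential kills the integrals over all cylinders about that point, and these
exhaust space-time. -/
lemma eq_zero_of_weightedPot_eq_zero {ε : ℝ} {L : ℝ≥0∞} {U : ℝ → ℝ≥0∞} (hU : IsA1 L U)
    {h : SpaceTime d → ℝ≥0∞} (hh : Measurable h) {z : SpaceTime d}
    (h0 : weightedPot ε U (fun w => h w * U w.1) z = 0) : ∀ᵐ w, h w = 0 := by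
  have hm : Measurable fun w : SpaceTime d => h w * U w.1 :=
    hh.mul (hU.measurable.comp measurable_fst)
  have h1 : ∀ j : ℕ, ∀ᵐ w ∂volume.restrict (cyl (j : ℤ) z), h w * U w.1 = 0 := by
    intro j
    have h2 := (ENNReal.tsum_eq_zero.1 h0) j
    simp only [mul_eq_zero, tw_ne_zero, false_or, ENNReal.inv_eq_zero, hU.ne_top, or_false,
      cylAvg] at h2
    exact (lintegral_eq_zero_iff hm).1 h2
  have h4 : ∀ᵐ w, h w * U w.1 = 0 := by
    rw [← Measure.restrict_univ (μ := volume), ← iUnion_cyl z]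
    exact (ae_restrict_iUnion_iff _ _).2 h1
  filter_upwards [h4] with w hw
  exact (mul_eq_zero.1 hw).resolve_right (hU.apply_ne_zero _)

/-- Weighted bounds for `b * rieszPot α f`, for the time weights `U` and `U ^ (1 - p)`. -/
theorem weighted_bound {α p q : ℝ} (hα : 0 < α) (hp : 1 < p) (hpq : p < q)
    {D L : ℝ≥0∞} (hD : D ≠ ⊤) (hL : L ≠ ⊤) :
    ∃ C : ℝ≥0∞, C ≠ ⊤ ∧ ∀ (U : ℝ → ℝ≥0∞) (b f : SpaceTime d → ℝ≥0∞), IsA1 L U → Measurable b →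
      Measurable f → SliceBound (α * q) D (fun w => b w ^ q) →
        ∫⁻ z, U z.1 * (b z * rieszPot α f z) ^ p ≤ C * ∫⁻ z, U z.1 * f z ^ p ∧
        ∫⁻ z, U z.1 ^ (1 - p) * (b z * rieszPot α f z) ^ p ≤
          C * ∫⁻ z, U z.1 ^ (1 - p) * f z ^ p := by
  obtain ⟨ε, δ, a, s, κ, hε, hεδ, hαδ, hεp, ha, ha1, hs, hsa, hκ, hκ1, hκs⟩ :=
    exists_exponents hα hp hpq
  have hp0 : 0 < p := by linarith
  have hq0 : 0 < q := by linarith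
  have hp1 : 0 < p - 1 := by linarith
  have hδ : 0 < δ := hα.trans hαδ
  have ha0 : 0 < a := (div_pos hα hδ).trans ha
  have hpq0 : 0 ≤ p / q := by positivity
  have hpq1 : 0 ≤ 1 - p / q := sub_nonneg.2 ((div_le_one hq0).2 hpq.le)
  obtain ⟨C₀, hC₀, hpot⟩ := scaleBound_weightedPot (d := d) hεδ hε hδ hD hL
  have hcv : unitVol d ≠ ⊤ := unitVol_ne_top
  have hmul : ∀ x : ℝ, 0 ≤ x → x ≤ 1 → C₀ ^ x * unitVol d ^ (1 - x) ≠ ⊤ := fun x hx hx1 =>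
    ENNReal.mul_ne_top (ENNReal.rpow_ne_top_of_nonneg hx hC₀)
      (ENNReal.rpow_ne_top_of_nonneg (sub_nonneg.2 hx1) hcv)
  have hCa := hmul a ha0.le ha1
  have hCκ := hmul κ hκ hκ1
  have hCb : (D + 1) ^ (p / q) * (C₀ ^ κ * unitVol d ^ (1 - κ)) ^ (1 - p / q) ≠ ⊤ :=
    ENNReal.mul_ne_top (ENNReal.rpow_ne_top_of_nonneg hpq0 (by simp [hD]))
      (ENNReal.rpow_ne_top_of_nonneg hpq1 hCκ)
  have hαa : α < 0 + δ * a := by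
    rw [div_lt_iff₀ hδ] at ha; linarith
  have hαb : α < p / q * ε + (1 - p / q) * 0 +
      δ * (p / q * 1 + (1 - p / q) * κ) := by
    have e1 : p / q * ε + (1 - p / q) * 0 + δ * (p / q * 1 + (1 - p / q) * κ) =
        p / q * (ε + δ) + δ * (κ * (1 - p / q)) := by ring
    rw [e1, ← hεδ, hκs]
    have e2 : p / q * (α * q) = α * p := by field_simp
    rw [e2]
    nlinarith [mul_pos hδ hs]
  obtain ⟨C₁, hC₁, hR₁⟩ := ScaleBound.rieszPot_le (d := d) (α := α) (ε := 0) (θ := a) hδ hα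
    hαa hCa hL
  obtain ⟨C₂, hC₂, hR₂⟩ := ScaleBound.rieszPot_le (d := d) (α := α)
    (ε := p / q * ε + (1 - p / q) * 0) (θ := p / q * 1 + (1 - p / q) * κ) hδ
    (by linarith) hαb hCb hL
  have hex₁ : (0 + δ * a - α) / δ * (p - 1) = s := by
    rw [hsa]; field_simp; ring
  have hex₂ : (p / q * ε + (1 - p / q) * 0 + δ * (p / q * 1 + (1 - p / q) * κ) - α) / δ =
      a * (p - 1) := by
    have e1 : p / q * ε + (1 - p / q) * 0 + δ * (p / q * 1 + (1 - p / q) * κ) - α =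
        p / q * (ε + δ) + δ * (κ * (1 - p / q)) - α := by ring
    rw [e1, ← hεδ, hκs, hsa]; field_simp; ring
  rw [hex₂] at hR₂
  set e := (0 + δ * a - α) / δ with he
  refine ⟨C₁ ^ (p - 1) * C₂, ENNReal.mul_ne_top (ENNReal.rpow_ne_top_of_nonneg hp1.le hC₁) hC₂, ?_⟩
  intro U b f hU hb hf hbD
  have hbq : Measurable fun w => b w ^ q := by fun_prop
  set Ω : SpaceTime d → ℝ≥0∞ := weightedPot ε U fun w => b w ^ q * U w.1 with hΩ
  have hUm := hU.measurable
  have hΩm : Measurable Ω := measurable_weightedPot hU.measurable (by fun_prop) ε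
  have hΩΩ : ScaleBound C₀ 0 1 δ U Ω Ω := hpot U _ hU hbq hbD
  have hΩt := ae_lt_top_of_scaleBound hC₀ hU hΩm hΩΩ
  -- A zero of `Ω` forces `b = 0` almost everywhere, where both bounds are trivial. Otherwise the
  -- Schur test functions never vanish.
  by_cases hzero : ∃ z, Ω z = 0
  · obtain ⟨z, hz⟩ := hzero
    have hb0 : ∀ᵐ w, b w = 0 := by
      filter_upwards [eq_zero_of_weightedPot_eq_zero hU hbq hz] with w hw
      exact (ENNReal.rpow_eq_zero_iff_of_pos hq0).1 hw
    constructor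
    · rw [lintegral_congr_ae (g := fun _ => 0)]
      · simp
      · filter_upwards [hb0] with w hw
        simp [hw, ENNReal.zero_rpow_of_pos hp0]
    · rw [lintegral_congr_ae (g := fun _ => 0)]
      · simp
      · filter_upwards [hb0] with w hw
        simp [hw, ENNReal.zero_rpow_of_pos hp0]
  push Not at hzero
  have hone := scaleBound_one hU.measurable δ Ω
  have hpow : ∀ x, 0 ≤ x → x ≤ 1 →
      ScaleBound (C₀ ^ x * unitVol d ^ (1 - x)) 0 x δ U Ω (fun w => Ω w ^ x) := by
    intro x hx hx1
    have := hΩΩ.holder hone hU.measurable hΩm measurable_const hx (sub_nonneg.2 hx1)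
      (by ring) zero_le_one le_rfl
    simpa using this
  have hba : ScaleBound ((D + 1) ^ (p / q) * (C₀ ^ κ * unitVol d ^ (1 - κ)) ^ (1 - p / q))
      (p / q * ε + (1 - p / q) * 0) (p / q * 1 + (1 - p / q) * κ) δ U Ω
      (fun w => b w ^ p * Ω w ^ s) := by
    have := (hbD.scaleBound hεδ hbq hU).holder (hpow κ hκ hκ1) hU.measurable hbq
      (hΩm.pow_const κ) hpq0 hpq1 (by ring) zero_le_one hκ
    have e1 : q * (p / q) = p := by field_simp
    simpa only [← ENNReal.rpow_mul, hκs, e1] using this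
  have hr₁ := hR₁ U Ω _ hU (hΩm.pow_const a) (hpow a ha0.le ha1)
  have hr₂ := hR₂ U Ω _ hU (by fun_prop) hba
  have hWs : ∀ z, (Ω z ^ e) ^ (p - 1) = Ω z ^ s := by
    intro z
    rw [← ENNReal.rpow_mul, hex₁]
  constructor
  · refine schur_test (V := fun z => U z.1) (H := fun z => Ω z ^ a) (W := fun z => Ω z ^ e)
      hp hb hf (by fun_prop) (by fun_prop) (by fun_prop) ?_ ?_ (fun z => (hr₁ z).2) ?_
    · refine Filter.Eventually.of_forall fun z => ?_
      simp [ENNReal.rpow_eq_zero_iff, hzero z, ha0.le]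
    · filter_upwards [hΩt] with z hz
      exact ENNReal.rpow_ne_top_of_nonneg ha0.le hz.ne
    · refine Filter.Eventually.of_forall fun z => ?_
      simp only [hWs]
      convert (hr₂ z).1 using 2
      · ext w; ring
      · rw [← ENNReal.rpow_mul, mul_comm]
  -- Compared with the weight `U`, the two halves of `ScaleBound.rieszPot_le` exchange roles: the
  -- factor `U` now sits in `H` and `W`, and `W ^ (p - 1)` cancels `V`.
  · refine schur_test (V := fun z => U z.1 ^ (1 - p)) (H := fun z => Ω z ^ a * U z.1)
      (W := fun z => Ω z ^ e * U z.1)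
      hp hb hf (by fun_prop) (by fun_prop) (by fun_prop) ?_ ?_ (fun z => (hr₁ z).1) ?_
    · refine Filter.Eventually.of_forall fun z => ?_
      simp [ENNReal.rpow_eq_zero_iff, hzero z, ha0.le, hU.apply_ne_zero]
    · filter_upwards [hΩt, hU.ae_lt_top_fst] with z hz hz'
      exact ENNReal.mul_ne_top (ENNReal.rpow_ne_top_of_nonneg ha0.le hz.ne) hz'.ne
    · filter_upwards [hU.ae_lt_top_fst] with z hz
      calc _ ≤ rieszPot α (fun w => b w ^ p * Ω w ^ s) z := by
            refine rieszPot_mono (fun w => ?_) z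
            rw [ENNReal.mul_rpow_of_nonneg _ _ hp1.le, hWs]
            calc _ = b w ^ p * Ω w ^ s * (U w.1 ^ (-(p - 1)) * U w.1 ^ (p - 1)) := by
                  rw [neg_sub]; ring
              _ ≤ b w ^ p * Ω w ^ s * 1 := by
                gcongr; exact rpow_mul_rpow_neg_le_one _ hp1
              _ = _ := mul_one _
        _ ≤ C₂ * Ω z ^ (a * (p - 1)) := (hr₂ z).2
        _ = _ := by
          rw [ENNReal.mul_rpow_of_nonneg _ _ hp1.le, ← ENNReal.rpow_mul]
          have : U z.1 ^ (1 - p) * U z.1 ^ (p - 1) = 1 := by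
            rw [← ENNReal.rpow_add _ _ (hU.apply_ne_zero _) hz.ne]; simp
          rw [mul_left_comm (U z.1 ^ (1 - p)), this, mul_one]

/-! ### The maximal function on the line. -/

/-- The maximal function over centred intervals of radius `4 ^ j`. -/
def maxFun (v : ℝ → ℝ≥0∞) (t : ℝ) : ℝ≥0∞ := ⨆ j : ℤ, timeAvg j v t

lemma measurable_maxFun {v : ℝ → ℝ≥0∞} (hv : Measurable v) : Measurable (maxFun v) :=
  Measurable.iSup fun j => measurable_timeAvg hv j

/-- The truncation `j ≤ n` bounds the radii, as the Vitali covering lemma requires. The constant 10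
is the fivefold enlargement times the length 2 of an interval of radius 1. -/
lemma mul_volume_truncated_maxFun_le {v : ℝ → ℝ≥0∞} (l : ℝ≥0∞) (n : ℤ) :
    l * volume {t | ∃ j ≤ n, l < timeAvg j v t} ≤ 10 * ∫⁻ t, v t := by
  set T : Set (ℝ × ℤ) := {p | p.2 ≤ n ∧ l < timeAvg p.2 v p.1} with hT
  obtain ⟨u, huT, hdisj, hcov⟩ := Vitali.exists_disjoint_subfamily_covering_enlargement_ball T
    (fun p => p.1) (fun p => (2 : ℝ) ^ (2 * p.2 : ℝ)) ((2 : ℝ) ^ (2 * n : ℝ))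
    (fun p hp => Real.rpow_le_rpow_of_exponent_le one_le_two (by
      have : (p.2 : ℝ) ≤ n := by exact_mod_cast hp.1
      linarith)) 5 (by norm_num)
  have hcount : u.Countable := hdisj.countable_of_isOpen (fun _ _ => Metric.isOpen_ball)
    (fun p _ => Metric.nonempty_ball.2 (by positivity))
  have hsub : {t | ∃ j ≤ n, l < timeAvg j v t} ⊆
      ⋃ p ∈ u, Metric.ball p.1 (5 * (2 : ℝ) ^ (2 * p.2 : ℝ)) := by
    rintro t ⟨j, hj, hl⟩
    obtain ⟨p, hp, hsub⟩ := hcov (t, j) ⟨hj, hl⟩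
    exact Set.mem_biUnion hp (hsub (Metric.mem_ball_self (by positivity)))
  have hball : ∀ p ∈ u, l * volume (Metric.ball p.1 (5 * (2 : ℝ) ^ (2 * p.2 : ℝ))) ≤
      10 * ∫⁻ t in Metric.ball p.1 ((2 : ℝ) ^ (2 * p.2 : ℝ)), v t := by
    intro p hp
    have h1 : l ≤ timeAvg p.2 v p.1 := (huT hp).2.le
    rw [Real.volume_ball, ← mul_assoc, ENNReal.ofReal_mul (by norm_num), ofReal_two_rpow]
    have e : ENNReal.ofReal (2 * 5) = 10 := by norm_num
    rw [e]
    calc _ ≤ timeAvg p.2 v p.1 * (10 * tw (2 * p.2)) := by gcongr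
      _ = 10 * (tw (2 * p.2) * tw (-(2 * p.2))) *
          ∫⁻ t in Metric.ball p.1 ((2 : ℝ) ^ (2 * p.2 : ℝ)), v t := by
        rw [timeAvg]; ring
      _ = _ := by rw [tw_mul_tw_neg, mul_one]
  calc _ ≤ l * ∑' p : u, volume (Metric.ball p.1.1 (5 * (2 : ℝ) ^ (2 * p.1.2 : ℝ))) := by
        gcongr
        exact (measure_mono hsub).trans (measure_biUnion_le _ hcount _)
    _ ≤ ∑' p : u, 10 * ∫⁻ t in Metric.ball p.1.1 ((2 : ℝ) ^ (2 * p.1.2 : ℝ)), v t := by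
        rw [← ENNReal.tsum_mul_left]
        exact ENNReal.tsum_le_tsum fun p => hball p.1 p.2
    _ = 10 * ∫⁻ t in ⋃ p ∈ u, Metric.ball p.1 ((2 : ℝ) ^ (2 * p.2 : ℝ)), v t := by
        rw [ENNReal.tsum_mul_left,
          lintegral_biUnion hcount (fun _ _ => Metric.isOpen_ball.measurableSet) hdisj]
    _ ≤ _ := by gcongr; exact Measure.restrict_le_self

/-- The weak type `(1, 1)` bound for the maximal function. -/
lemma mul_volume_maxFun_le {v : ℝ → ℝ≥0∞} (l : ℝ≥0∞) :
    l * volume {t | l < maxFun v t} ≤ 10 * ∫⁻ t, v t := by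
  have h1 : {t | l < maxFun v t} = ⋃ n : ℕ, {t | ∃ j ≤ (n : ℤ), l < timeAvg j v t} := by
    ext t
    simp only [maxFun, lt_iSup_iff, Set.mem_ofPred_eq, Set.mem_iUnion]
    constructor
    · rintro ⟨j, hj⟩
      exact ⟨j.toNat, j, Int.self_le_toNat j, hj⟩
    · rintro ⟨n, j, -, hj⟩
      exact ⟨j, hj⟩
  have h2 : Monotone fun n : ℕ => {t | ∃ j ≤ (n : ℤ), l < timeAvg j v t} := by
    rintro a b hab t ⟨j, hj, hl⟩
    exact ⟨j, hj.trans (by exact_mod_cast hab), hl⟩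
  rw [h1, h2.measure_iUnion, ENNReal.mul_iSup]
  exact iSup_le fun n => mul_volume_truncated_maxFun_le l n

/-- A discrete layer-cake bound: for finite nonzero `X` the single term with `2 ^ k < X ≤ 2 ^ (k +
1)` suffices, and for `X = ⊤` the terms are unbounded. -/
lemma rpow_le_tsum_tw {m : ℝ} (hm : 0 < m) (X : ℝ≥0∞) :
    X ^ m ≤ ∑' k : ℤ, if tw k < X then tw (m * (k + 1)) else 0 := by
  rcases eq_or_ne X 0 with rfl | h0
  · simp [ENNReal.zero_rpow_of_pos hm]
  rcases eq_or_ne X ⊤ with rfl | ht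
  · rw [ENNReal.top_rpow_of_pos hm, top_le_iff]
    by_contra h
    set S := ∑' k : ℤ, if tw k < ⊤ then tw (m * (k + 1)) else 0 with hS
    have hterm : ∀ k : ℤ, tw (m * (k + 1)) ≤ S := fun k => by
      refine le_trans (le_of_eq ?_) (ENNReal.le_tsum k)
      simp [(tw_ne_top _).lt_top]
    have hS0 : S ≠ 0 := fun hS0 => tw_ne_zero _ (le_antisymm (hS0 ▸ hterm 0) zero_le)
    obtain ⟨y, hy⟩ := exists_eq_tw hS0 h
    have h1 := hterm ⌈y / m⌉
    rw [hy] at h1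
    refine absurd (tw_lt_tw.2 ?_) (not_lt.2 h1)
    have h2 := Int.le_ceil (y / m)
    rw [div_le_iff₀ hm] at h2
    linarith
  · obtain ⟨x, rfl⟩ := exists_eq_tw h0 ht
    refine le_trans ?_ (ENNReal.le_tsum (⌈x⌉ - 1))
    have h1 := Int.le_ceil x
    have h2 := Int.ceil_lt_add_one x
    rw [if_pos, tw_rpow]
    · apply tw_mono
      push_cast
      nlinarith
    · rw [tw_lt_tw]
      push_cast
      linarith

lemma timeAvg_add {u v : ℝ → ℝ≥0∞} (hu : Measurable u) (j : ℤ) (t : ℝ) :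
    timeAvg j (fun τ => u τ + v τ) t = timeAvg j u t + timeAvg j v t := by
  rw [timeAvg, lintegral_add_left hu, mul_add, timeAvg, timeAvg]

/-- The part of `v` not exceeding `2 ^ (k - 2)` has normalised integrals at most `2 ^ (k - 1)`,
since `timeAvg` doubles constants; the large part must supply the rest. -/
lemma maxFun_lt_of_lt {v : ℝ → ℝ≥0∞} (hv : Measurable v) (k : ℝ) {t : ℝ}
    (h : tw k < maxFun v t) :
    tw (k - 1) < maxFun (fun τ => if tw (k - 2) < v τ then v τ else 0) t := by
  by_contra! h'
  refine absurd h (not_lt.2 (iSup_le fun j => ?_))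
  have hm : Measurable fun τ => if tw (k - 2) < v τ then v τ else 0 :=
    Measurable.ite (measurableSet_lt measurable_const hv) hv measurable_const
  calc timeAvg j v t ≤ timeAvg j (fun τ => (if tw (k - 2) < v τ then v τ else 0) + tw (k - 2)) t := by
        refine timeAvg_mono_on j t fun τ _ => ?_
        split_ifs with h1
        · exact le_self_add
        · rw [zero_add]; exact not_lt.1 h1
    _ ≤ tw (k - 1) + 2 * tw (k - 2) := by
        rw [timeAvg_add hm, timeAvg_const]
        gcongr
        exact (le_iSup (fun j => timeAvg j _ t) j).trans h'
    _ = tw k := by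
        have h2 : ∀ x, tw (x + 1) = 2 * tw x := fun x => by
          rw [tw_add, mul_comm]; simp [tw]
        have e1 := h2 (k - 2)
        have e2 := h2 (k - 1)
        rw [← e1, show k - 2 + 1 = k - 1 by ring, ← two_mul, ← e2, sub_add_cancel]

/-- The strong type bound for the maximal function. -/
theorem lintegral_maxFun_rpow_le {m : ℝ} (hm : 1 < m) :
    ∃ C : ℝ≥0∞, C ≠ ⊤ ∧ ∀ v : ℝ → ℝ≥0∞, Measurable v →
      ∫⁻ t, maxFun v t ^ m ≤ C * ∫⁻ t, v t ^ m := by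
  have hm0 : 0 < m := by linarith
  obtain ⟨C, hC, hgeo⟩ := tsum_tw_lt (σ := m - 1) (by linarith)
  refine ⟨10 * tw (3 * m - 1) * C, ENNReal.mul_ne_top (ENNReal.mul_ne_top (by norm_num)
    (tw_ne_top _)) hC, fun v hv => ?_⟩
  set w : ℤ → ℝ → ℝ≥0∞ := fun k τ => if tw ((k : ℝ) - 2) < v τ then v τ else 0 with hw
  have hwm : ∀ k, Measurable (w k) := fun k =>
    Measurable.ite (measurableSet_lt measurable_const hv) hv measurable_const
  have hlevel : ∀ k : ℤ, ∫⁻ t, (if tw k < maxFun v t then tw (m * (k + 1)) else 0) ≤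
      10 * tw (m * (k + 1) - (k - 1)) * ∫⁻ t, w k t := by
    intro k
    have h1 : ∫⁻ t, (if tw k < maxFun v t then tw (m * (k + 1)) else 0) =
        tw (m * (k + 1)) * volume {t | tw k < maxFun v t} := by
      rw [← lintegral_indicator_const (measurableSet_lt measurable_const (measurable_maxFun hv))]
      refine lintegral_congr fun t => ?_
      simp [Set.indicator]
    rw [h1]
    calc _ ≤ tw (m * (k + 1)) * volume {t | tw ((k : ℝ) - 1) < maxFun (w k) t} :=
          mul_le_mul_right (measure_mono fun t ht => maxFun_lt_of_lt hv k ht) _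
      _ = tw (m * (k + 1) - (k - 1)) *
          (tw ((k : ℝ) - 1) * volume {t | tw ((k : ℝ) - 1) < maxFun (w k) t}) := by
        rw [← mul_assoc, ← tw_add, sub_add_cancel]
      _ ≤ tw (m * (k + 1) - (k - 1)) * (10 * ∫⁻ t, w k t) :=
        mul_le_mul_right (mul_volume_maxFun_le _) _
      _ = _ := by ring
  have hsum : ∀ t, ∑' k : ℤ, 10 * tw (m * (k + 1) - (k - 1)) * w k t ≤
      10 * tw (3 * m - 1) * C * v t ^ m := by
    intro t
    -- Shifting `k` by 2 turns the cutoff `2 ^ (k - 2) < v` into `2 ^ k < v`, leaving a geometric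
    -- series in `2 ^ ((m - 1) k)`.
    rw [← (Equiv.addRight (2 : ℤ)).tsum_eq]
    calc _ ≤ ∑' k : ℤ, 10 * tw (3 * m - 1) * v t *
          (if tw k < v t then tw ((m - 1) * k) else 0) := by
          refine ENNReal.tsum_le_tsum fun k => ?_
          have e1 : ((k + 2 : ℤ) : ℝ) - 2 = k := by push_cast; ring
          simp only [hw, Equiv.coe_addRight, e1]
          split_ifs
          · have e2 : m * (((k + 2 : ℤ) : ℝ) + 1) - (((k + 2 : ℤ) : ℝ) - 1) =
                3 * m - 1 + (m - 1) * k := by push_cast; ring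
            rw [e2, tw_add]
            apply le_of_eq; ring
          · simp
      _ ≤ 10 * tw (3 * m - 1) * v t * (C * v t ^ (m - 1)) := by
        rw [ENNReal.tsum_mul_left]; gcongr; exact hgeo _
      _ = 10 * tw (3 * m - 1) * C * (v t ^ (1 : ℝ) * v t ^ (m - 1)) := by
        rw [ENNReal.rpow_one]; ring
      _ = _ := by
        rw [← ENNReal.rpow_add_of_nonneg _ _ zero_le_one (by linarith)]
        congr 2; ring
  calc _ ≤ ∫⁻ t, ∑' k : ℤ, (if tw k < maxFun v t then tw (m * (k + 1)) else 0) :=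
        lintegral_mono fun t => rpow_le_tsum_tw hm0 _
    _ = ∑' k : ℤ, ∫⁻ t, (if tw k < maxFun v t then tw (m * (k + 1)) else 0) := by
        refine lintegral_tsum fun k => Measurable.aemeasurable ?_
        exact Measurable.ite (measurableSet_lt measurable_const (measurable_maxFun hv))
          measurable_const measurable_const
    _ ≤ ∑' k : ℤ, ∫⁻ t, 10 * tw (m * (k + 1) - (k - 1)) * w k t := by
        refine ENNReal.tsum_le_tsum fun k => (hlevel k).trans (le_of_eq ?_)
        rw [lintegral_const_mul _ (hwm k)]
    _ = ∫⁻ t, ∑' k : ℤ, 10 * tw (m * (k + 1) - (k - 1)) * w k t := by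
        rw [lintegral_tsum fun k => ((hwm k).const_mul _).aemeasurable]
    _ ≤ ∫⁻ t, 10 * tw (3 * m - 1) * C * v t ^ m := lintegral_mono hsum
    _ = _ := by rw [lintegral_const_mul _ (by fun_prop)]

/-! ### Majorants in `A₁`. -/

lemma ae_eq_zero_of_timeAvg_eq_zero {v : ℝ → ℝ≥0∞} (hv : Measurable v) {t : ℝ}
    (h : ∀ j : ℤ, timeAvg j v t = 0) : ∀ᵐ τ, v τ = 0 := by
  have h1 : ∀ j : ℕ, ∀ᵐ τ ∂volume.restrict (Metric.ball t ((2 : ℝ) ^ (2 * (j : ℤ) : ℝ))),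
      v τ = 0 := by
    intro j
    have h2 := h j
    simp only [timeAvg, mul_eq_zero, tw_ne_zero, false_or] at h2
    exact (lintegral_eq_zero_iff hv).1 h2
  rw [← Measure.restrict_univ (μ := volume), ← iUnion_ball_two_rpow t]
  exact (ae_restrict_iUnion_iff _ _).2 h1

lemma le_self_rpow_add_one (x : ℝ≥0∞) {m : ℝ} (hm : 1 ≤ m) : x ≤ 1 + x ^ m := by
  rcases le_total x 1 with h | h
  · exact h.trans le_self_add
  · calc x = x ^ (1 : ℝ) := (ENNReal.rpow_one x).symm
      _ ≤ x ^ m := ENNReal.rpow_le_rpow_of_exponent_le h hm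
      _ ≤ _ := le_add_self

/-- Every function in `L^m` of the line has an `A₁` majorant of comparable norm. -/
theorem exists_isA1_majorant {m : ℝ} (hm : 1 < m) :
    ∃ L C : ℝ≥0∞, L ≠ ⊤ ∧ C ≠ ⊤ ∧ ∀ v : ℝ → ℝ≥0∞, Measurable v → ∫⁻ t, v t ^ m ≠ 0 →
      ∫⁻ t, v t ^ m ≠ ⊤ →
        ∃ U : ℝ → ℝ≥0∞, IsA1 L U ∧ (∀ t, v t ≤ U t) ∧ ∫⁻ t, U t ^ m ≤ C * ∫⁻ t, v t ^ m := by
  have hm0 : 0 < m := by linarith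
  obtain ⟨C, hC, hmax⟩ := lintegral_maxFun_rpow_le hm
  -- A bound for the norm of `maxFun` on `L^m`, with 1 added so that `c` is invertible.
  set c : ℝ≥0∞ := C ^ (1 / m) + 1 with hc
  have hct : c ≠ ⊤ := ENNReal.add_ne_top.2
    ⟨ENNReal.rpow_ne_top_of_nonneg (by positivity) hC, ENNReal.one_ne_top⟩
  have hc0 : c ≠ 0 := by simp [hc]
  have hcm : C ≤ c ^ m := by
    calc C = (C ^ (1 / m)) ^ m := by
          rw [← ENNReal.rpow_mul, one_div_mul_cancel hm0.ne', ENNReal.rpow_one]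
      _ ≤ _ := by gcongr; exact le_self_add
  set S1 : ℝ≥0∞ := ∑' n : ℕ, tw (-1 * n) with hS1
  set S2 : ℝ≥0∞ := ∑' n : ℕ, tw (-m * n) with hS2
  have hS1t : S1 ≠ ⊤ := tsum_nat_tw_ne_top one_pos
  have hS2t : S2 ≠ ⊤ := tsum_nat_tw_ne_top hm0
  refine ⟨tw 2 * c, S1 ^ m * S2, ENNReal.mul_ne_top (tw_ne_top _) hct,
    ENNReal.mul_ne_top (ENNReal.rpow_ne_top_of_nonneg hm0.le hS1t) hS2t, ?_⟩
  intro v hv hv0 hvt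
  set y : ℕ → ℝ → ℝ≥0∞ := fun n => maxFun^[n] v with hy
  have hy0 : y 0 = v := rfl
  have hys : ∀ n, y (n + 1) = maxFun (y n) := fun n => Function.iterate_succ_apply' _ _ _
  have hym : ∀ n, Measurable (y n) := by
    intro n
    induction n with
    | zero => exact hv
    | succ n ih => rw [hys]; exact measurable_maxFun ih
  have hyint : ∀ n, ∫⁻ t, (c⁻¹ ^ n * y n t) ^ m ≤ ∫⁻ t, v t ^ m := by
    intro n
    induction n with
    | zero => simp [hy0]
    | succ n ih =>
      refine le_trans ?_ ih
      simp_rw [ENNReal.mul_rpow_of_nonneg _ _ hm0.le]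
      rw [lintegral_const_mul _ ((hym _).pow_const m), lintegral_const_mul _ ((hym _).pow_const m),
        hys]
      calc _ ≤ (c⁻¹ ^ (n + 1)) ^ m * (c ^ m * ∫⁻ t, y n t ^ m) := by
            gcongr
            exact (hmax _ (hym n)).trans (mul_le_mul_left hcm _)
        _ = (c⁻¹ ^ (n + 1) * c) ^ m * ∫⁻ t, y n t ^ m := by
          rw [ENNReal.mul_rpow_of_nonneg _ _ hm0.le, mul_assoc]
        _ = _ := by
          rw [pow_succ, mul_assoc, ENNReal.inv_mul_cancel hc0 hct, mul_one]
  -- The Rubio de Francia series `∑ (4 c) ^ (-n) M^n v`: averaging moves each term to the next one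
  -- at the cost of `4 c`, which becomes the `A₁` constant.
  set U : ℝ → ℝ≥0∞ := fun t => ∑' n : ℕ, tw (-2 * n) * (c⁻¹ ^ n * y n t) with hU
  have htermm : ∀ n : ℕ, Measurable fun t => tw (-2 * n) * (c⁻¹ ^ n * y n t) := fun n =>
    ((hym n).const_mul _).const_mul _
  have hUm : Measurable U := Measurable.tsum htermm
  have hUint : ∫⁻ t, U t ^ m ≤ S1 ^ m * S2 * ∫⁻ t, v t ^ m := by
    -- In place of Minkowski, half of the decay `4 ^ (-n)` bounds each term by the `m`-th root of a
    -- series, and the other half sums.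
    have h1 : ∀ t, U t ^ m ≤ S1 ^ m * ∑' n : ℕ, tw (-m * n) * (c⁻¹ ^ n * y n t) ^ m := by
      intro t
      set Z := ∑' n : ℕ, tw (-m * n) * (c⁻¹ ^ n * y n t) ^ m with hZ
      have h2 : ∀ n : ℕ, tw (-1 * n) * (c⁻¹ ^ n * y n t) ≤ Z ^ (1 / m) := by
        intro n
        rw [one_div, ENNReal.le_rpow_inv_iff hm0, ENNReal.mul_rpow_of_nonneg _ _ hm0.le, tw_rpow]
        have e : -1 * (n : ℝ) * m = -m * n := by ring
        rw [e]
        exact ENNReal.le_tsum (f := fun n : ℕ => tw (-m * n) * (c⁻¹ ^ n * y n t) ^ m) n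
      calc U t ^ m ≤ (∑' n : ℕ, tw (-1 * n) * Z ^ (1 / m)) ^ m := by
            gcongr ?_ ^ m
            refine ENNReal.tsum_le_tsum fun n => ?_
            have e : -2 * (n : ℝ) = -1 * n + -1 * n := by ring
            rw [e, tw_add, mul_assoc]
            gcongr
            exact h2 n
        _ = _ := by
          rw [ENNReal.tsum_mul_right, ENNReal.mul_rpow_of_nonneg _ _ hm0.le, ← ENNReal.rpow_mul,
            one_div_mul_cancel hm0.ne', ENNReal.rpow_one]
    have hm2 : ∀ n : ℕ, Measurable fun t => (c⁻¹ ^ n * y n t) ^ m := fun n =>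
      ((hym n).const_mul _).pow_const m
    have hm3 : ∀ n : ℕ, Measurable fun t => tw (-m * n) * (c⁻¹ ^ n * y n t) ^ m := fun n =>
      (hm2 n).const_mul _
    calc _ ≤ ∫⁻ t, S1 ^ m * ∑' n : ℕ, tw (-m * n) * (c⁻¹ ^ n * y n t) ^ m := lintegral_mono h1
      _ = S1 ^ m * ∑' n : ℕ, tw (-m * n) * ∫⁻ t, (c⁻¹ ^ n * y n t) ^ m := by
        rw [lintegral_const_mul _ (Measurable.tsum hm3), lintegral_tsum fun n => (hm3 n).aemeasurable]
        congr 2 with n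
        rw [lintegral_const_mul _ (hm2 n)]
      _ ≤ S1 ^ m * ∑' n : ℕ, tw (-m * n) * ∫⁻ t, v t ^ m :=
        mul_le_mul_right (ENNReal.tsum_le_tsum fun n => mul_le_mul_right (hyint n) _) _
      _ = _ := by rw [ENNReal.tsum_mul_right]; ring
  have hvU : ∀ t, v t ≤ U t := by
    intro t
    refine le_trans (le_of_eq ?_)
      (ENNReal.le_tsum (f := fun n : ℕ => tw (-2 * n) * (c⁻¹ ^ n * y n t)) 0)
    simp [hy0, tw_zero]
  have hA1 : ∀ (j : ℤ) (t : ℝ), timeAvg j U t ≤ tw 2 * c * U t := by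
    intro j t
    have e1 : timeAvg j U t = ∑' n : ℕ, tw (-2 * n) * (c⁻¹ ^ n * timeAvg j (y n) t) := by
      rw [timeAvg, lintegral_tsum fun n => (htermm n).aemeasurable, ← ENNReal.tsum_mul_left]
      refine tsum_congr fun n => ?_
      rw [lintegral_const_mul _ ((hym n).const_mul _), lintegral_const_mul _ (hym n), timeAvg]
      ring
    rw [e1]
    calc _ ≤ ∑' n : ℕ, tw 2 * c * (tw (-2 * (n + 1 : ℕ)) * (c⁻¹ ^ (n + 1) * y (n + 1) t)) := by
          refine ENNReal.tsum_le_tsum fun n => ?_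
          have e2 : tw (-2 * n) = tw 2 * tw (-2 * (n + 1 : ℕ)) := by
            rw [← tw_add]; congr 1; push_cast; ring
          have e3 : c⁻¹ ^ n = c * c⁻¹ ^ (n + 1) := by
            rw [pow_succ', ← mul_assoc, ENNReal.mul_inv_cancel hc0 hct, one_mul]
          rw [e2, e3, hys]
          calc _ ≤ tw 2 * tw (-2 * (n + 1 : ℕ)) * (c * c⁻¹ ^ (n + 1) * maxFun (y n) t) := by
                gcongr
                exact le_iSup (fun j => timeAvg j (y n) t) j
            _ = _ := by ring
      _ ≤ _ := by
          rw [ENNReal.tsum_mul_left]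
          gcongr
          exact ENNReal.tsum_comp_le_tsum_of_injective (add_left_injective 1)
            (fun n : ℕ => tw (-2 * n) * (c⁻¹ ^ n * y n t))
  -- At a zero of `U` all averages of `U`, hence of `v`, would vanish, so `v` would be zero almost
  -- everywhere.
  have hUpos : ∀ t, U t ≠ 0 := by
    intro t ht
    apply hv0
    rw [lintegral_eq_zero_iff (hv.pow_const m)]
    have h1 : ∀ j : ℤ, timeAvg j v t = 0 := by
      intro j
      have h2 := hA1 j t
      rw [ht, mul_zero, nonpos_iff_eq_zero] at h2
      exact le_antisymm ((timeAvg_mono_on j t fun τ _ => hvU τ).trans h2.le) zero_le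
    filter_upwards [ae_eq_zero_of_timeAvg_eq_zero hv h1] with τ hτ
    simp [hτ, ENNReal.zero_rpow_of_pos hm0]
  refine ⟨U, ⟨hUm, hA1, ?_, ?_⟩, hvU, hUint⟩
  · intro j t h
    simp only [timeAvg, mul_eq_zero, tw_ne_zero, false_or] at h
    rw [lintegral_eq_zero_iff hUm] at h
    have h1 : (volume.restrict (Metric.ball t ((2 : ℝ) ^ (2 * j : ℝ)))) ≠ 0 := by
      rw [Ne, Measure.restrict_eq_zero]
      exact (Metric.measure_ball_pos volume t (by positivity)).ne'
    have := ae_neBot.2 h1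
    obtain ⟨τ, hτ⟩ := h.exists
    exact hUpos τ hτ
  · intro j t
    refine ENNReal.mul_ne_top (tw_ne_top _) (ne_top_of_le_ne_top ?_
      (lintegral_mono fun τ => le_self_rpow_add_one (U τ) hm.le))
    rw [lintegral_add_left measurable_const, setLIntegral_const, one_mul]
    refine ENNReal.add_ne_top.2 ⟨measure_ball_lt_top.ne, ne_top_of_le_ne_top ?_
      ((setLIntegral_le_lintegral _ _).trans hUint)⟩
    exact ENNReal.mul_ne_top (ENNReal.mul_ne_top (ENNReal.rpow_ne_top_of_nonneg hm0.le hS1t) hS2t)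
      hvt

/-! ### Extrapolation in the time exponent. -/

lemma isA1_one : IsA1 2 fun _ => 1 where
  measurable := measurable_const
  timeAvg_le j t := by rw [timeAvg_const]
  ne_zero j t := by rw [timeAvg_const]; norm_num
  ne_top j t := by rw [timeAvg_const]; norm_num

lemma IsA1.mono {L L' : ℝ≥0∞} {U : ℝ → ℝ≥0∞} (hU : IsA1 L U) (h : L ≤ L') : IsA1 L' U where
  measurable := hU.measurable
  timeAvg_le j t := (hU.timeAvg_le j t).trans (mul_le_mul_left h _)
  ne_zero := hU.ne_zero
  ne_top := hU.ne_top

lemma rpow_neg_anti {x y : ℝ≥0∞} {a : ℝ} (ha : 0 ≤ a) (h : x ≤ y) : y ^ (-a) ≤ x ^ (-a) := by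
  rw [ENNReal.rpow_neg, ENNReal.rpow_neg]
  exact ENNReal.inv_le_inv.2 (ENNReal.rpow_le_rpow h ha)

lemma lintegral_rpow_eq_zero_of_lintegral_eq_zero {F : ℝ → ℝ≥0∞} (hF : Measurable F) {a b : ℝ}
    (ha : 0 < a) (hb : 0 < b) (h : ∫⁻ t, F t ^ a = 0) : ∫⁻ t, F t ^ b = 0 := by
  rw [lintegral_eq_zero_iff (hF.pow_const a)] at h
  rw [lintegral_eq_zero_iff (hF.pow_const b)]
  filter_upwards [h] with t ht
  have : F t = 0 := (ENNReal.rpow_eq_zero_iff_of_pos ha).1 ht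
  simp [this, ENNReal.zero_rpow_of_pos hb]

lemma lintegral_rpow_eq_zero_of_unweighted {F G : ℝ → ℝ≥0∞} (hF : Measurable F)
    (hG : Measurable G) {a : ℝ} (ha : 0 < a) {C : ℝ≥0∞} (h : ∫⁻ t, G t ≤ C * ∫⁻ t, F t)
    (h0 : ∫⁻ t, F t ^ a = 0) : ∫⁻ t, G t ^ a = 0 := by
  have h1 := lintegral_rpow_eq_zero_of_lintegral_eq_zero hF ha one_pos h0
  simp only [ENNReal.rpow_one] at h1
  rw [h1, mul_zero, nonpos_iff_eq_zero] at h
  exact lintegral_rpow_eq_zero_of_lintegral_eq_zero hG one_pos ha (by simpa using h)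

/-- Extrapolation to exponents below `p`, from the weights `U ^ (1 - p)` with `U` in `A₁`. -/
theorem extrapolation_of_lt {p r : ℝ} (hr : 1 < r) (hrp : r < p) :
    ∃ L : ℝ≥0∞, L ≠ ⊤ ∧ ∀ C : ℝ≥0∞, C ≠ ⊤ → ∃ C' : ℝ≥0∞, C' ≠ ⊤ ∧ ∀ F G : ℝ → ℝ≥0∞,
      Measurable F → Measurable G →
      (∀ U, IsA1 L U → ∫⁻ t, U t ^ (1 - p) * G t ≤ C * ∫⁻ t, U t ^ (1 - p) * F t) →
      ∫⁻ t, F t ^ (r / p) ≠ ⊤ → ∫⁻ t, G t ^ (r / p) ≤ C' * ∫⁻ t, F t ^ (r / p) := by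
  have hp : 1 < p := hr.trans hrp
  have hp0 : 0 < p := by linarith
  have hp1 : 0 < p - 1 := by linarith
  have hpr : 0 < p - r := by linarith
  have hrp0 : 0 < r / p := by positivity
  have hrp1 : 0 < 1 - r / p := sub_pos.2 ((div_lt_one hp0).2 hrp)
  -- Chosen so that Hölder with exponents `r / p` and `1 - r / p` pairs `U ^ (1 - p)` with `U ^ m`
  -- and the powers of `U` cancel.
  set m := r * (p - 1) / (p - r) with hm
  have hm1 : 1 < m := by
    rw [hm, lt_div_iff₀ hpr]; nlinarith
  obtain ⟨L, Cm, hL, hCm, hmaj⟩ := exists_isA1_majorant hm1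
  refine ⟨L + 2, ENNReal.add_ne_top.2 ⟨hL, by norm_num⟩, fun C hC =>
    ⟨C ^ (r / p) * Cm ^ (1 - r / p), ENNReal.mul_ne_top
      (ENNReal.rpow_ne_top_of_nonneg hrp0.le hC) (ENNReal.rpow_ne_top_of_nonneg hrp1.le hCm), ?_⟩⟩
  intro F G hF hG hw hFt
  by_cases hF0 : ∫⁻ t, F t ^ (r / p) = 0
  · have h1 := hw _ (isA1_one.mono (le_add_self : (2 : ℝ≥0∞) ≤ L + 2))
    simp only [ENNReal.one_rpow, one_mul] at h1
    rw [lintegral_rpow_eq_zero_of_unweighted hF hG hrp0 h1 hF0]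
    exact zero_le
  -- With `U ≥ F ^ e` one gets `U ^ (1 - p) F ≤ F ^ (1 - e (p - 1)) = F ^ (r / p)`, while `e m = r /
  -- p` makes `F ^ e` lie in `L^m`.
  set e := (p - r) / (p * (p - 1)) with he
  have he0 : 0 < e := by positivity
  have hem : e * m = r / p := by rw [he, hm]; field_simp
  have hvm : ∀ t, (F t ^ e) ^ m = F t ^ (r / p) := fun t => by rw [← ENNReal.rpow_mul, hem]
  obtain ⟨U, hU, hvU, hUint⟩ := hmaj (fun t => F t ^ e) (hF.pow_const e)
    (by simp_rw [hvm]; exact hF0) (by simp_rw [hvm]; exact hFt)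
  simp_rw [hvm] at hUint
  have hUm := hU.measurable
  have h1 := hw U (hU.mono le_self_add)
  have h2 : ∀ t, U t ^ (1 - p) * F t ≤ F t ^ (r / p) := by
    intro t
    rcases eq_or_ne (F t) 0 with h0 | h0
    · simp [h0]
    rcases eq_or_ne (F t) ⊤ with ht | ht
    · simp [ht, ENNReal.top_rpow_of_pos hrp0]
    calc _ ≤ (F t ^ e) ^ (1 - p) * F t := by
          rw [← neg_sub p 1]
          exact mul_le_mul_left (rpow_neg_anti hp1.le (hvU t)) _
      _ = F t ^ (e * (1 - p)) * F t ^ (1 : ℝ) := by rw [ENNReal.rpow_one, ← ENNReal.rpow_mul]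
      _ = _ := by
        rw [← ENNReal.rpow_add _ _ h0 ht]
        congr 1
        rw [he]; field_simp; ring
  have h3 : ∫⁻ t, G t ^ (r / p) =
      ∫⁻ t, (U t ^ (1 - p) * G t) ^ (r / p) * (U t ^ m) ^ (1 - r / p) := by
    refine lintegral_congr_ae ?_
    filter_upwards [hU.ae_lt_top] with t ht
    rw [ENNReal.mul_rpow_of_nonneg _ _ hrp0.le, ← ENNReal.rpow_mul, ← ENNReal.rpow_mul]
    have e1 : U t ^ ((1 - p) * (r / p)) * U t ^ (m * (1 - r / p)) = 1 := by
      rw [← ENNReal.rpow_add _ _ (hU.apply_ne_zero t) ht.ne]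
      have : (1 - p) * (r / p) + m * (1 - r / p) = 0 := by
        rw [hm]; field_simp; ring
      rw [this, ENNReal.rpow_zero]
    calc _ = G t ^ (r / p) * (U t ^ ((1 - p) * (r / p)) * U t ^ (m * (1 - r / p))) := by
          rw [e1, mul_one]
      _ = _ := by ring
  rw [h3]
  refine (ENNReal.lintegral_mul_norm_pow_le (by fun_prop) (by fun_prop) hrp0.le hrp1.le
    (by ring)).trans ?_
  calc _ ≤ (C * ∫⁻ t, F t ^ (r / p)) ^ (r / p) * (Cm * ∫⁻ t, F t ^ (r / p)) ^ (1 - r / p) := by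
        gcongr
        exact h1.trans (mul_le_mul_right (lintegral_mono h2) _)
    _ = C ^ (r / p) * Cm ^ (1 - r / p) *
        ((∫⁻ t, F t ^ (r / p)) ^ (r / p) * (∫⁻ t, F t ^ (r / p)) ^ (1 - r / p)) := by
      rw [ENNReal.mul_rpow_of_nonneg _ _ hrp0.le, ENNReal.mul_rpow_of_nonneg _ _ hrp1.le]
      ring
    _ = _ := by rw [mul_rpow_add hrp0.le hrp1.le (by ring)]

/-- Extrapolation to exponents above `p`, from the weights in `A₁`. -/
theorem extrapolation_of_gt {p r : ℝ} (hp : 1 < p) (hpr : p < r) :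
    ∃ L : ℝ≥0∞, L ≠ ⊤ ∧ ∀ C : ℝ≥0∞, C ≠ ⊤ → ∃ C' : ℝ≥0∞, C' ≠ ⊤ ∧ ∀ F G : ℝ → ℝ≥0∞,
      Measurable F → Measurable G →
      (∀ U, IsA1 L U → ∫⁻ t, U t * G t ≤ C * ∫⁻ t, U t * F t) →
      ∫⁻ t, G t ^ (r / p) ≤ C' * ∫⁻ t, F t ^ (r / p) := by
  have hp0 : 0 < p := by linarith
  have hr0 : 0 < r := by linarith
  have hrp : 0 < r - p := by linarith
  have hθ : 0 < r / p := by positivity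
  have ha : 0 < p / r := by positivity
  have hb : 0 < 1 - p / r := sub_pos.2 ((div_lt_one hr0).2 hpr)
  set m := r / (r - p) with hm
  have hm1 : 1 < m := by rw [hm, lt_div_iff₀ hrp]; linarith
  have hm0 : 0 < m := by linarith
  obtain ⟨L, Cm, hL, hCm, hmaj⟩ := exists_isA1_majorant hm1
  refine ⟨L, hL, fun C hC => ⟨(C * Cm ^ (1 - p / r)) ^ (r / p),
    ENNReal.rpow_ne_top_of_nonneg hθ.le (ENNReal.mul_ne_top hC
      (ENNReal.rpow_ne_top_of_nonneg hb.le hCm)), ?_⟩⟩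
  intro F G hF hG hw
  set X := ∫⁻ t, F t ^ (r / p) with hX
  -- Truncating in height and space makes the integral finite, so that it can be cancelled below;
  -- monotone convergence removes the truncation.
  set w : ℕ → ℝ → ℝ≥0∞ := fun n =>
    (Metric.ball (0 : ℝ) n).indicator fun t => min (G t) n ^ (r / p) with hwdef
  have hwm : ∀ n, Measurable (w n) := fun n =>
    ((hG.min measurable_const).pow_const _).indicator Metric.isOpen_ball.measurableSet
  have hwt : ∀ n, ∫⁻ t, w n t ≠ ⊤ := by
    intro n
    rw [lintegral_indicator Metric.isOpen_ball.measurableSet]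
    refine ne_top_of_le_ne_top ?_ (lintegral_mono fun t =>
      (ENNReal.rpow_le_rpow (min_le_right _ _) hθ.le : _ ≤ (n : ℝ≥0∞) ^ (r / p)))
    rw [setLIntegral_const]
    exact ENNReal.mul_ne_top (ENNReal.rpow_ne_top_of_nonneg hθ.le (ENNReal.natCast_ne_top n))
      measure_ball_lt_top.ne
  have hbound : ∀ n, ∫⁻ t, w n t ≤ (C * Cm ^ (1 - p / r)) ^ (r / p) * X := by
    intro n
    by_cases h0 : ∫⁻ t, w n t = 0
    · rw [h0]; exact zero_le
    set Y := ∫⁻ t, w n t with hY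
    have hvm : ∀ t, (w n t ^ (1 / m)) ^ m = w n t := fun t => by
      rw [← ENNReal.rpow_mul, one_div_mul_cancel hm0.ne', ENNReal.rpow_one]
    obtain ⟨U, hU, hvU, hUint⟩ := hmaj (fun t => w n t ^ (1 / m)) ((hwm n).pow_const _)
      (by simp_rw [hvm]; exact h0) (by simp_rw [hvm]; exact hwt n)
    simp_rw [hvm] at hUint
    have hUm := hU.measurable
    -- The majorant of `w ^ (1 / m)` plays the dual function: `1 / m + p / r = 1`, so its product
    -- with `G` is at least `w`.
    have h1 : Y ≤ C * (X ^ (p / r) * (Cm * Y) ^ (1 - p / r)) := by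
      calc Y ≤ ∫⁻ t, U t * G t := by
            refine lintegral_mono fun t => ?_
            by_cases ht : t ∈ Metric.ball (0 : ℝ) n
            · refine le_trans (le_of_eq ?_) (mul_le_mul' (hvU t) (min_le_left (G t) n))
              simp only [hwdef, Set.indicator_of_mem ht]
              nth_rewrite 3 [← ENNReal.rpow_one (min (G t) n)]
              rw [← ENNReal.rpow_mul, ← ENNReal.rpow_add_of_nonneg _ _ (by positivity) zero_le_one]
              congr 1
              rw [hm]; field_simp; ring
            · simp only [hwdef, Set.indicator_of_notMem ht]; exact zero_le
        _ ≤ C * ∫⁻ t, U t * F t := hw U hU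
        _ = C * ∫⁻ t, (F t ^ (r / p)) ^ (p / r) * (U t ^ m) ^ (1 - p / r) := by
            congr 1
            refine lintegral_congr fun t => ?_
            rw [← ENNReal.rpow_mul, ← ENNReal.rpow_mul]
            have e1 : r / p * (p / r) = 1 := by field_simp
            have e2 : m * (1 - p / r) = 1 := by rw [hm]; field_simp
            rw [e1, e2, ENNReal.rpow_one, ENNReal.rpow_one, mul_comm]
        _ ≤ C * (X ^ (p / r) * (∫⁻ t, U t ^ m) ^ (1 - p / r)) := by
            gcongr
            exact ENNReal.lintegral_mul_norm_pow_le (by fun_prop) (by fun_prop) ha.le hb.le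
              (by ring)
        _ ≤ _ := by gcongr
    have hYp0 : Y ^ (1 - p / r) ≠ 0 := by
      rw [Ne, ENNReal.rpow_eq_zero_iff_of_pos hb]
      exact h0
    have hYpt : Y ^ (1 - p / r) ≠ ⊤ := ENNReal.rpow_ne_top_of_nonneg hb.le (hwt n)
    have h2 : Y ^ (p / r) * Y ^ (1 - p / r) ≤
        C * Cm ^ (1 - p / r) * X ^ (p / r) * Y ^ (1 - p / r) := by
      rw [mul_rpow_add ha.le hb.le (by ring)]
      refine h1.trans (le_of_eq ?_)
      rw [ENNReal.mul_rpow_of_nonneg _ _ hb.le]; ring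
    have h3 := (ENNReal.mul_le_mul_iff_left hYp0 hYpt).1 h2
    have e1 : p / r * (r / p) = 1 := by field_simp
    calc Y = (Y ^ (p / r)) ^ (r / p) := by rw [← ENNReal.rpow_mul, e1, ENNReal.rpow_one]
      _ ≤ (C * Cm ^ (1 - p / r) * X ^ (p / r)) ^ (r / p) := by gcongr
      _ = _ := by
        rw [ENNReal.mul_rpow_of_nonneg _ _ hθ.le, ← ENNReal.rpow_mul X, e1, ENNReal.rpow_one]
  have hlim : Filter.Tendsto (fun n => ∫⁻ t, w n t) Filter.atTop
      (nhds (∫⁻ t, G t ^ (r / p))) := by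
    refine lintegral_tendsto_of_tendsto_of_monotone (fun n => (hwm n).aemeasurable)
      (Filter.Eventually.of_forall fun t => ?_) (Filter.Eventually.of_forall fun t => ?_)
    · intro a b hab
      have hab' : (a : ℝ) ≤ b := by exact_mod_cast hab
      have hab'' : (a : ℝ≥0∞) ≤ b := by exact_mod_cast hab
      refine (Set.indicator_le_indicator_of_subset (Metric.ball_subset_ball hab')
        (fun _ => zero_le) t).trans (Set.indicator_le_indicator ?_)
      gcongr
    · have h1 : Filter.Tendsto (fun n : ℕ => min (G t) n ^ (r / p)) Filter.atTop
          (nhds (G t ^ (r / p))) := by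
        have h2 : Filter.Tendsto (fun n : ℕ => min (G t) (n : ℝ≥0∞)) Filter.atTop
            (nhds (min (G t) ⊤)) := tendsto_const_nhds.min ENNReal.tendsto_nat_nhds_top
        rw [min_eq_left le_top] at h2
        exact (ENNReal.continuous_rpow_const.tendsto _).comp h2
      refine h1.congr' ?_
      obtain ⟨N, hN⟩ := exists_nat_gt |t|
      filter_upwards [Filter.eventually_ge_atTop N] with n hn
      have hn' : (N : ℝ) ≤ n := by exact_mod_cast hn
      have ht : t ∈ Metric.ball (0 : ℝ) n := by
        rw [mem_ball_zero_iff, Real.norm_eq_abs]; linarith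
      simp only [hwdef, Set.indicator_of_mem ht]
  exact le_of_tendsto' hlim hbound

/-! ### The mixed-norm bound for the Riesz potential. -/

lemma lintegral_time_mul {V : ℝ → ℝ≥0∞} {h : SpaceTime d → ℝ≥0∞} (hV : Measurable V)
    (hh : Measurable h) :
    ∫⁻ z : SpaceTime d, V z.1 * h z = ∫⁻ t, V t * ∫⁻ x, h (t, x) := by
  rw [Measure.volume_eq_prod, lintegral_prod _ (by fun_prop)]
  refine lintegral_congr fun t => ?_
  have hm : Measurable fun x => h (t, x) := by fun_prop
  exact lintegral_const_mul (V t) hm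

/-- The mixed-norm bound for `b * rieszPot α f`. -/
theorem mixed_bound {α p q r : ℝ} (hα : 0 < α) (hp : 1 < p) (hpq : p < q) (hr : 1 < r)
    {D : ℝ≥0∞} (hD : D ≠ ⊤) :
    ∃ C : ℝ≥0∞, C ≠ ⊤ ∧ ∀ b f : SpaceTime d → ℝ≥0∞, Measurable b → Measurable f →
      SliceBound (α * q) D (fun w => b w ^ q) →
      ∫⁻ t, (∫⁻ x, f (t, x) ^ p) ^ (r / p) ≠ ⊤ →
        ∫⁻ t, (∫⁻ x, (b (t, x) * rieszPot α f (t, x)) ^ p) ^ (r / p) ≤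
          C * ∫⁻ t, (∫⁻ x, f (t, x) ^ p) ^ (r / p) := by
  have hmeasF : ∀ f : SpaceTime d → ℝ≥0∞, Measurable f →
      Measurable fun t => ∫⁻ x, f (t, x) ^ p := fun f hf =>
    (hf.pow_const p).lintegral_prod_right'
  have hmeasG : ∀ b f : SpaceTime d → ℝ≥0∞, Measurable b → Measurable f →
      Measurable fun z => (b z * rieszPot α f z) ^ p := fun b f hb hf =>
    (hb.mul (measurable_rieszPot α hf)).pow_const p
  rcases lt_trichotomy r p with hlt | heq | hgt
  · obtain ⟨L, hL, hex⟩ := extrapolation_of_lt hr hlt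
    obtain ⟨C₀, hC₀, hw⟩ := weighted_bound (d := d) hα hp hpq hD hL
    obtain ⟨C, hC, hfin⟩ := hex C₀ hC₀
    refine ⟨C, hC, fun b f hb hf hbD hft => hfin _ _ (hmeasF f hf)
      (hmeasG b f hb hf).lintegral_prod_right' (fun U hU => ?_) hft⟩
    have hUm := hU.measurable.pow_const (1 - p)
    have h1 := (hw U b f hU hb hf hbD).2
    rw [lintegral_time_mul hUm (hmeasG b f hb hf),
      lintegral_time_mul (V := fun t => U t ^ (1 - p)) hUm (hf.pow_const p)] at h1
    exact h1
  · obtain ⟨C₀, hC₀, hw⟩ := weighted_bound (d := d) hα hp hpq hD (L := 2) (by norm_num)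
    refine ⟨C₀, hC₀, fun b f hb hf hbD _ => ?_⟩
    have h1 := (hw _ b f isA1_one hb hf hbD).1
    rw [lintegral_time_mul measurable_const (hmeasG b f hb hf),
      lintegral_time_mul measurable_const (hf.pow_const p)] at h1
    rw [heq, div_self (by linarith)]
    simpa using h1
  · obtain ⟨L, hL, hex⟩ := extrapolation_of_gt hp hgt
    obtain ⟨C₀, hC₀, hw⟩ := weighted_bound (d := d) hα hp hpq hD hL
    obtain ⟨C, hC, hfin⟩ := hex C₀ hC₀
    refine ⟨C, hC, fun b f hb hf hbD _ => hfin _ _ (hmeasF f hf)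
      (hmeasG b f hb hf).lintegral_prod_right' (fun U hU => ?_)⟩
    have h1 := (hw U b f hU hb hf hbD).1
    rw [lintegral_time_mul hU.measurable (hmeasG b f hb hf),
      lintegral_time_mul hU.measurable (hf.pow_const p)] at h1
    exact h1

/-! ### Domination of the heat-type kernel. -/

lemma rpow_mul_exp_neg_le {a k x : ℝ} (ha : 0 < a) (hk : 0 < k) (hx : 0 ≤ x) :
    x ^ a * Real.exp (-x / k) ≤ (a * k) ^ a := by
  have h1 : x / (a * k) ≤ Real.exp (x / (a * k)) := by
    linarith [Real.add_one_le_exp (x / (a * k))]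
  have h2 : (x / (a * k)) ^ a ≤ Real.exp (x / k) := by
    calc _ ≤ Real.exp (x / (a * k)) ^ a := Real.rpow_le_rpow (by positivity) h1 ha.le
      _ = _ := by rw [← Real.exp_mul]; congr 1; field_simp
  rw [Real.div_rpow hx (by positivity), div_le_iff₀ (by positivity)] at h2
  rw [neg_div, Real.exp_neg, ← div_eq_mul_inv, div_le_iff₀ (Real.exp_pos _)]
  linarith

/-- For `ρ ^ 2 ≤ s` the exponential is at most 1; for `ρ ^ 2 ≥ s` its decay beats the power of `ρ ^
2 / s`. -/
lemma kernel_le {α k s ρ : ℝ} (hα : α < d + 2) (hk : 0 < k) (hs : 0 < s) :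
    kernel d α k s ρ ≤ (1 + (((d : ℝ) + 2 - α) / 2 * k) ^ (((d : ℝ) + 2 - α) / 2)) *
      (max s (ρ ^ 2)) ^ (-(((d : ℝ) + 2 - α) / 2)) := by
  set a := ((d : ℝ) + 2 - α) / 2 with ha
  have ha0 : 0 < a := by rw [ha]; linarith
  have hc : 0 ≤ (a * k) ^ a := by positivity
  rw [kernel, if_pos hs]
  rcases le_total (ρ ^ 2) s with h | h
  · rw [max_eq_left h, Real.rpow_neg hs.le, div_eq_mul_inv]
    gcongr
    refine le_trans (Real.exp_le_one_iff.2 ?_) (by linarith)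
    rw [neg_div]
    exact neg_nonpos.2 (by positivity)
  · have hρ : 0 < ρ ^ 2 := hs.trans_le h
    rw [max_eq_right h, Real.rpow_neg hρ.le, ← div_eq_mul_inv]
    have h1 := rpow_mul_exp_neg_le ha0 hk (x := ρ ^ 2 / s) (by positivity)
    have e : -(ρ ^ 2 / s) / k = -ρ ^ 2 / (k * s) := by field_simp
    rw [e, Real.div_rpow hρ.le hs.le] at h1
    rw [div_le_div_iff₀ (by positivity) (by positivity)]
    rw [div_mul_eq_mul_div, div_le_iff₀ (by positivity)] at h1
    have h2 : 0 ≤ s ^ a := by positivity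
    linarith

/-- The heat-type kernel is dominated by the dyadic parabolic Riesz kernel. -/
lemma ofReal_kernel_le {α k : ℝ} (hα : α < d + 2) (hk : 0 < k) :
    ∃ N : ℝ≥0∞, N ≠ ⊤ ∧ ∀ z w : SpaceTime d,
      ENNReal.ofReal (kernel d α k w.1 ‖w.2‖) ≤ N * rieszKer α z (z + w) := by
  set a := ((d : ℝ) + 2 - α) / 2 with ha
  have ha0 : 0 < a := by rw [ha]; linarith
  set c := 1 + (a * k) ^ a with hc
  have hc0 : 0 ≤ c := by positivity
  refine ⟨ENNReal.ofReal c * tw (2 * a), ENNReal.mul_ne_top ENNReal.ofReal_ne_top (tw_ne_top _), ?_⟩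
  intro z w
  by_cases hs : 0 < w.1
  · set R := max w.1 (‖w.2‖ ^ 2) with hR
    have hR0 : 0 < R := lt_max_of_lt_left hs
    have hRy : R = 2 ^ Real.logb 2 R := (Real.rpow_logb two_pos (by norm_num) hR0).symm
    set y := Real.logb 2 R with hy
    -- The least `j` with `R < 4 ^ j`. Then `R ≥ 4 ^ (j - 1)`, which accounts for the lost factor `2
    -- ^ (2 a)`.
    set j : ℤ := ⌊y / 2⌋ + 1 with hj
    have hj1 : y < 2 * j := by
      have := Int.lt_floor_add_one (y / 2)
      rw [hj]; push_cast; linarith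
    have hj2 : 2 * j - 2 ≤ y := by
      have := Int.floor_le (y / 2)
      rw [hj]; push_cast; linarith
    have hRj : R < (2 : ℝ) ^ (2 * j : ℝ) := by
      rw [hRy]; exact Real.rpow_lt_rpow_of_exponent_lt one_lt_two hj1
    have hmem : z + w ∈ cyl j z := by
      rw [mem_cyl]
      constructor
      · have : dist (z + w).1 z.1 = w.1 := by
          rw [Prod.fst_add, dist_eq_norm, add_sub_cancel_left, Real.norm_of_nonneg hs.le]
        rw [this]
        exact (le_max_left _ _).trans_lt hRj
      · have : dist (z + w).2 z.2 = ‖w.2‖ := by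
          rw [Prod.snd_add, dist_eq_norm, add_sub_cancel_left]
        rw [this]
        refine lt_of_pow_lt_pow_left₀ 2 (by positivity) ?_
        refine ((le_max_right _ _).trans_lt hRj).trans_le (le_of_eq ?_)
        rw [← Real.rpow_natCast, ← Real.rpow_mul two_pos.le]
        congr 1; push_cast; ring
    calc _ ≤ ENNReal.ofReal (c * R ^ (-a)) := ENNReal.ofReal_le_ofReal (kernel_le hα hk hs)
      _ = ENNReal.ofReal c * tw (y * -a) := by
        rw [ENNReal.ofReal_mul hc0, hRy, ← Real.rpow_mul two_pos.le, ofReal_two_rpow]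
      _ ≤ ENNReal.ofReal c * tw (2 * a + (α * j + -((d + 2) * j))) := by
        gcongr
        apply tw_mono
        have e : α * j + -(((d : ℝ) + 2) * j) = -(2 * a * j) := by rw [ha]; ring
        rw [e]
        nlinarith
      _ = ENNReal.ofReal c * tw (2 * a) * (tw (α * j) * tw (-((d + 2) * j))) := by
        rw [tw_add, tw_add, mul_assoc]
      _ ≤ _ := by
        gcongr
        refine le_trans (le_of_eq ?_) (ENNReal.le_tsum j)
        rw [Set.indicator_of_mem hmem]
  · rw [kernel, if_neg hs, ENNReal.ofReal_zero]
    exact zero_le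

lemma kernel_nonneg (α k s ρ : ℝ) : 0 ≤ kernel d α k s ρ := by
  rw [kernel]
  split_ifs with hs
  · positivity
  · exact le_rfl

lemma measurable_potentialIntegrand (α k : ℝ) {f : SpaceTime d → ℝ} (hf : Measurable f)
    (z : SpaceTime d) : Measurable (potentialIntegrand α k f z) := by
  unfold potentialIntegrand kernel
  refine Measurable.mul ?_ (hf.comp (measurable_const_add z))
  refine Measurable.ite (measurableSet_lt measurable_const measurable_fst) ?_ measurable_const
  fun_prop

lemma lintegral_potentialIntegrand_le {α k : ℝ} (hα : α < d + 2) (hk : 0 < k) :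
    ∃ N : ℝ≥0∞, N ≠ ⊤ ∧ ∀ (f : SpaceTime d → ℝ) (z : SpaceTime d),
      ∫⁻ w, ‖potentialIntegrand α k f z w‖ₑ ≤ N * rieszPot α (fun w => ‖f w‖ₑ) z := by
  obtain ⟨N, hN, h⟩ := ofReal_kernel_le (d := d) hα hk
  refine ⟨N, hN, fun f z => ?_⟩
  calc _ ≤ ∫⁻ w, N * (rieszKer α z (z + w) * ‖f (z + w)‖ₑ) := by
        refine lintegral_mono fun w => ?_
        rw [potentialIntegrand, enorm_mul, Real.enorm_of_nonneg (kernel_nonneg _ _ _ _),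
          ← mul_assoc]
        gcongr
        exact h z w
    _ = N * ∫⁻ w, rieszKer α z (z + w) * ‖f (z + w)‖ₑ := lintegral_const_mul' _ _ hN
    _ = _ := by
        have : (volume : Measure (SpaceTime d)).IsAddLeftInvariant := by
          rw [Measure.volume_eq_prod]; infer_instance
        rw [rieszPot]
        congr 1
        exact lintegral_add_left_eq_self (fun w => rieszKer α z w * ‖f w‖ₑ) z

/-! ### From the Morrey norm to slice bounds, and the final estimate. -/

/-- Dividing `b` by `B` makes the slice constant independent of `b`, so one constant serves all `b`
and the Morrey norm enters linearly. -/
lemma sliceBound_of_morreyNorm_le {F : Type*} [NormedAddCommGroup F] {α q : ℝ} (hq : 0 < q)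
    {b : SpaceTime d → F} {B : ℝ≥0∞} (hB0 : B ≠ 0) (hBt : B ≠ ⊤) (h : morreyNorm α q b ≤ B) :
    SliceBound (α * q) (unitVol d) (fun z => (B⁻¹ * ‖b z‖ₑ) ^ q) := by
  intro t j x
  have hr : (0 : ℝ) < 2 ^ (j : ℝ) := by positivity
  set I := ∫⁻ y in Metric.ball x ((2 : ℝ) ^ (j : ℝ)), ‖b (t, y)‖ₑ ^ q with hI
  set vol := volume (Metric.ball x ((2 : ℝ) ^ (j : ℝ))) with hvol
  have hvol0 : vol ≠ 0 := (Metric.measure_ball_pos volume x hr).ne'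
  have hvolt : vol ≠ ⊤ := measure_ball_lt_top.ne
  have h1 : ENNReal.ofReal (((2 : ℝ) ^ (j : ℝ)) ^ α) * (vol⁻¹ * I) ^ (1 / q) ≤ B := by
    refine le_trans ?_ h
    refine le_trans ?_ (le_iSup _ t)
    refine le_trans ?_ (le_iSup₂ (α := ℝ≥0∞) ((2 : ℝ) ^ (j : ℝ)) hr)
    gcongr
    exact le_iSup (fun x => ((volume (Metric.ball x ((2 : ℝ) ^ (j : ℝ))))⁻¹ *
      ∫⁻ y in Metric.ball x ((2 : ℝ) ^ (j : ℝ)), ‖b (t, y)‖ₑ ^ q) ^ (1 / q)) x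
  rw [← Real.rpow_mul two_pos.le, ofReal_two_rpow] at h1
  have h2 : tw (α * q * j) * (vol⁻¹ * I) ≤ B ^ q := by
    calc _ = (tw (j * α) * (vol⁻¹ * I) ^ (1 / q)) ^ q := by
          rw [ENNReal.mul_rpow_of_nonneg _ _ hq.le, tw_rpow, ← ENNReal.rpow_mul,
            one_div_mul_cancel hq.ne', ENNReal.rpow_one]
          congr 2; ring
      _ ≤ _ := by gcongr
  have h3 : ∫⁻ y in Metric.ball x ((2 : ℝ) ^ (j : ℝ)), (B⁻¹ * ‖b (t, y)‖ₑ) ^ q =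
      B⁻¹ ^ q * I := by
    simp_rw [ENNReal.mul_rpow_of_nonneg _ _ hq.le]
    exact lintegral_const_mul' _ _ (ENNReal.rpow_ne_top_of_nonneg hq.le (ENNReal.inv_ne_top.2 hB0))
  have hv : vol = tw (d * j) * unitVol d := volume_ball_two_rpow x j
  rw [h3]
  calc B⁻¹ ^ q * I = B⁻¹ ^ q * (tw (α * q * j) * tw (-(α * q * j)) * (vol * vol⁻¹) * I) := by
        rw [tw_mul_tw_neg, ENNReal.mul_inv_cancel hvol0 hvolt, one_mul, one_mul]
    _ = B⁻¹ ^ q * (tw (α * q * j) * (vol⁻¹ * I)) * (tw (-(α * q * j)) * vol) := by ring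
    _ ≤ B⁻¹ ^ q * B ^ q * (tw (-(α * q * j)) * vol) := by gcongr
    _ = unitVol d * (tw (-(α * q * j)) * tw (d * j)) := by
        rw [← ENNReal.mul_rpow_of_nonneg _ _ hq.le, ENNReal.inv_mul_cancel hB0 hBt,
          ENNReal.one_rpow, hv]
        ring
    _ = _ := by
        rw [← tw_add]; congr 2; ring

/-- Balls smaller than `2 ^ n` use `γ ≤ d`; for larger ones the integral stops growing and `0 ≤ γ ≤
d` again suffices. -/
lemma sliceBound_indicator {γ : ℝ} (hγ : 0 ≤ γ) (hγd : γ ≤ d) {q : ℝ} (hq : 0 < q) (n : ℕ) :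
    SliceBound γ (unitVol d * tw (γ * n)) (fun z : SpaceTime d =>
      ((Metric.ball (0 : EuclideanSpace ℝ (Fin d)) ((2 : ℝ) ^ (n : ℝ))).indicator
        (fun _ => (1 : ℝ≥0∞)) z.2) ^ q) := by
  intro t j x
  have h0 : ∀ y, ((Metric.ball (0 : EuclideanSpace ℝ (Fin d)) ((2 : ℝ) ^ (n : ℝ))).indicator
        (fun _ => (1 : ℝ≥0∞)) y) ^ q =
      (Metric.ball (0 : EuclideanSpace ℝ (Fin d)) ((2 : ℝ) ^ (n : ℝ))).indicator
        (fun _ => (1 : ℝ≥0∞)) y := by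
    intro y
    by_cases hy : y ∈ Metric.ball (0 : EuclideanSpace ℝ (Fin d)) ((2 : ℝ) ^ (n : ℝ))
    · simp only [Set.indicator_of_mem hy, ENNReal.one_rpow]
    · simp only [Set.indicator_of_notMem hy, ENNReal.zero_rpow_of_pos hq]
  simp_rw [h0]
  rcases le_total (j : ℝ) n with h | h
  · calc _ ≤ ∫⁻ _ in Metric.ball x ((2 : ℝ) ^ (j : ℝ)), (1 : ℝ≥0∞) :=
          lintegral_mono fun y => Set.indicator_le_self' (fun _ _ => zero_le) y
      _ = unitVol d * tw (d * j) := by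
          rw [setLIntegral_const, one_mul, volume_ball_two_rpow, unitVol, mul_comm]
      _ ≤ _ := by
          rw [mul_assoc, ← tw_add]
          gcongr
          apply tw_mono
          nlinarith
  · calc _ ≤ ∫⁻ y, (Metric.ball (0 : EuclideanSpace ℝ (Fin d)) ((2 : ℝ) ^ (n : ℝ))).indicator
            (fun _ => (1 : ℝ≥0∞)) y := setLIntegral_le_lintegral _ _
      _ = unitVol d * tw (d * n) := by
          rw [lintegral_indicator_const Metric.isOpen_ball.measurableSet, one_mul,
            volume_ball_two_rpow, unitVol, mul_comm]
      _ ≤ _ := by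
          rw [mul_assoc, ← tw_add]
          gcongr
          apply tw_mono
          nlinarith

lemma mixedNorm_rpow {F : Type*} [NormedAddCommGroup F] {r : ℝ} (hr : 0 < r) (p : ℝ)
    (f : SpaceTime d → F) :
    mixedNorm r p f ^ r = ∫⁻ t, (∫⁻ x, ‖f (t, x)‖ₑ ^ p) ^ (r / p) := by
  rw [mixedNorm, ← ENNReal.rpow_mul, one_div_mul_cancel hr.ne', ENNReal.rpow_one]

/-- Apply `mixed_bound` with `b` the indicator of `ℝ` times a ball, then exhaust space by balls. -/
lemma ae_rieszPot_lt_top {α p q r : ℝ} (hα : 0 < α) (hp : 1 < p) (hpq : p < q) (hr : 1 < r)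
    (hαq : α * q ≤ d) {f : SpaceTime d → ℝ} (hf : Measurable f) (hfin : mixedNorm r p f < ⊤) :
    ∀ᵐ z, rieszPot α (fun w => ‖f w‖ₑ) z < ⊤ := by
  have hp0 : 0 < p := by linarith
  have hq : 0 < q := by linarith
  have hr0 : 0 < r := by linarith
  have hrp : 0 < r / p := by positivity
  have hfm : Measurable fun w => ‖f w‖ₑ := hf.enorm
  have hKm := measurable_rieszPot α hfm
  have hint : ∫⁻ t, (∫⁻ x, ‖f (t, x)‖ₑ ^ p) ^ (r / p) ≠ ⊤ := by
    rw [← mixedNorm_rpow hr0]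
    exact ENNReal.rpow_ne_top_of_nonneg hr0.le hfin.ne
  have hn : ∀ n : ℕ, ∀ᵐ z : SpaceTime d,
      z.2 ∈ Metric.ball (0 : EuclideanSpace ℝ (Fin d)) ((2 : ℝ) ^ (n : ℝ)) →
        rieszPot α (fun w => ‖f w‖ₑ) z < ⊤ := by
    intro n
    set b : SpaceTime d → ℝ≥0∞ := fun z =>
      (Metric.ball (0 : EuclideanSpace ℝ (Fin d)) ((2 : ℝ) ^ (n : ℝ))).indicator
        (fun _ => (1 : ℝ≥0∞)) z.2 with hb
    have hbm : Measurable b :=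
      (measurable_const.indicator Metric.isOpen_ball.measurableSet).comp measurable_snd
    obtain ⟨C, hC, hmix⟩ := mixed_bound (d := d) hα hp hpq hr
      (D := unitVol d * tw (α * q * n)) (ENNReal.mul_ne_top unitVol_ne_top (tw_ne_top _))
    have h1 := hmix b _ hbm hfm (sliceBound_indicator (by positivity) hαq hq n) hint
    have h2 := ne_top_of_le_ne_top (ENNReal.mul_ne_top hC hint) h1
    have hGm : Measurable fun z => (b z * rieszPot α (fun w => ‖f w‖ₑ) z) ^ p :=
      (hbm.mul hKm).pow_const p
    have h3 := MeasureTheory.ae_lt_top (hGm.lintegral_prod_right'.pow_const (r / p)) h2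
    have h4 : ∀ᵐ z : SpaceTime d, (b z * rieszPot α (fun w => ‖f w‖ₑ) z) ^ p < ⊤ := by
      rw [Measure.volume_eq_prod, Measure.ae_prod_iff_ae_ae (measurableSet_lt hGm measurable_const)]
      filter_upwards [h3] with t ht
      rw [ENNReal.rpow_lt_top_iff_of_pos hrp] at ht
      exact MeasureTheory.ae_lt_top (hGm.comp measurable_prodMk_left) ht.ne
    filter_upwards [h4] with z hz hzb
    rw [ENNReal.rpow_lt_top_iff_of_pos hp0] at hz
    simpa only [hb, Set.indicator_of_mem hzb, one_mul] using hz
  filter_upwards [ae_all_iff.2 hn] with z hz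
  obtain ⟨n, hn⟩ := pow_unbounded_of_one_lt ‖z.2‖ (one_lt_two (α := ℝ))
  refine hz n ?_
  rwa [mem_ball_zero_iff, Real.rpow_natCast]

lemma rieszPot_eq_zero_of_mixedNorm_eq_zero {α p r : ℝ} (hp : 0 < p) (hr : 0 < r)
    {f : SpaceTime d → ℝ} (hf : Measurable f) (h : mixedNorm r p f = 0) (z : SpaceTime d) :
    rieszPot α (fun w => ‖f w‖ₑ) z = 0 := by
  have hrp : 0 < r / p := by positivity
  have hfm : Measurable fun w : SpaceTime d => ‖f w‖ₑ ^ p := hf.enorm.pow_const p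
  have h1 : ∫⁻ t, (∫⁻ x, ‖f (t, x)‖ₑ ^ p) ^ (r / p) = 0 := by
    rw [← mixedNorm_rpow hr, h, ENNReal.zero_rpow_of_pos hr]
  have h2 := (lintegral_eq_zero_iff (hfm.lintegral_prod_right'.pow_const (r / p))).1 h1
  have h3 : ∫⁻ z : SpaceTime d, ‖f z‖ₑ ^ p = 0 := by
    rw [Measure.volume_eq_prod, lintegral_prod _ hfm.aemeasurable,
      lintegral_eq_zero_iff hfm.lintegral_prod_right']
    filter_upwards [h2] with t ht
    exact (ENNReal.rpow_eq_zero_iff_of_pos hrp).1 ht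
  have h4 := (lintegral_eq_zero_iff hfm).1 h3
  rw [rieszPot, lintegral_congr_ae (g := fun _ => 0), lintegral_zero]
  filter_upwards [h4] with w hw
  have hw0 : ‖f w‖ₑ = 0 := (ENNReal.rpow_eq_zero_iff_of_pos hp).1 hw
  rw [hw0, mul_zero]

/-- The mixed-norm bound for any function dominated by `‖b‖ * |potential α k f|`. -/
theorem mixedNorm_le_of_enorm_le {α p q r k : ℝ} (hα : 0 < α) (hαd : α < d + 2) (hk : 0 < k)
    (hp : 1 < p) (hpq : p < q) (hr : 1 < r) :
    ∃ N : ℝ≥0, ∀ f : SpaceTime d → ℝ, Measurable f → mixedNorm r p f < ⊤ →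
      ∀ {F : Type} [NormedAddCommGroup F] (b h : SpaceTime d → F), Measurable (fun z => ‖b z‖ₑ) →
        (∀ z, ‖h z‖ₑ ≤ ‖b z‖ₑ * ‖potential α k f z‖ₑ) →
          mixedNorm r p h ≤ N * morreyNorm α q b * mixedNorm r p f := by
  have hp0 : 0 < p := by linarith
  have hq0 : 0 < q := by linarith
  have hr0 : 0 < r := by linarith
  have hrp : 0 < r / p := by positivity
  obtain ⟨K, hK, hker⟩ := lintegral_potentialIntegrand_le (d := d) hαd hk
  obtain ⟨C, hC, hmix⟩ := mixed_bound (d := d) hα hp hpq hr unitVol_ne_top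
  -- The 1 keeps `N` nonzero, so the bound is `⊤` when the Morrey norm is infinite and `f` has
  -- nonzero norm.
  set N : ℝ≥0∞ := K * C ^ (1 / r) + 1 with hN
  have hNt : N ≠ ⊤ := ENNReal.add_ne_top.2 ⟨ENNReal.mul_ne_top hK
    (ENNReal.rpow_ne_top_of_nonneg (by positivity) hC), ENNReal.one_ne_top⟩
  refine ⟨N.toNNReal, ?_⟩
  rw [ENNReal.coe_toNNReal hNt]
  intro f hf hfin F _ b h hb hh
  have hfm : Measurable fun w => ‖f w‖ₑ := hf.enorm
  have hint : ∫⁻ t, (∫⁻ x, ‖f (t, x)‖ₑ ^ p) ^ (r / p) ≠ ⊤ := by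
    rw [← mixedNorm_rpow hr0]
    exact ENNReal.rpow_ne_top_of_nonneg hr0.le hfin.ne
  have hpot : ∀ z, ‖h z‖ₑ ≤ K * (‖b z‖ₑ * rieszPot α (fun w => ‖f w‖ₑ) z) := by
    intro z
    refine (hh z).trans ?_
    rw [mul_left_comm]
    gcongr
    exact (enorm_integral_le_lintegral_enorm _).trans (hker f z)
  have hmain : ∀ B : ℝ≥0∞, B ≠ 0 → B ≠ ⊤ → morreyNorm α q b ≤ B →
      mixedNorm r p h ≤ N * B * mixedNorm r p f := by
    intro B hB0 hBt hB
    have h1 := hmix (fun z => B⁻¹ * ‖b z‖ₑ) _ (hb.const_mul _) hfm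
      (sliceBound_of_morreyNorm_le hq0 hB0 hBt hB) hint
    have hKB : K * B ≠ ⊤ := ENNReal.mul_ne_top hK hBt
    have h2 : ∀ z, ‖h z‖ₑ ≤ K * B * (B⁻¹ * ‖b z‖ₑ * rieszPot α (fun w => ‖f w‖ₑ) z) := by
      intro z
      refine (hpot z).trans (le_of_eq ?_)
      calc _ = K * (B * B⁻¹) * (‖b z‖ₑ * rieszPot α (fun w => ‖f w‖ₑ) z) := by
            rw [ENNReal.mul_inv_cancel hB0 hBt, mul_one]
        _ = _ := by ring
    have h3 : ∫⁻ t, (∫⁻ x, ‖h (t, x)‖ₑ ^ p) ^ (r / p) ≤ (K * B) ^ r *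
        (C * ∫⁻ t, (∫⁻ x, ‖f (t, x)‖ₑ ^ p) ^ (r / p)) := by
      refine le_trans ?_ (mul_le_mul_right h1 _)
      rw [← lintegral_const_mul' _ _ (ENNReal.rpow_ne_top_of_nonneg hr0.le hKB)]
      refine lintegral_mono fun t => ?_
      calc _ ≤ (∫⁻ x, (K * B) ^ p *
            (B⁻¹ * ‖b (t, x)‖ₑ * rieszPot α (fun w => ‖f w‖ₑ) (t, x)) ^ p) ^ (r / p) := by
            refine ENNReal.rpow_le_rpow (lintegral_mono fun x => ?_) hrp.le
            rw [← ENNReal.mul_rpow_of_nonneg _ _ hp0.le]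
            exact ENNReal.rpow_le_rpow (h2 _) hp0.le
        _ = _ := by
            rw [lintegral_const_mul' _ _ (ENNReal.rpow_ne_top_of_nonneg hp0.le hKB),
              ENNReal.mul_rpow_of_nonneg _ _ hrp.le, ← ENNReal.rpow_mul,
              mul_div_cancel₀ _ hp0.ne']
    have hr1 : 0 ≤ 1 / r := by positivity
    calc mixedNorm r p h ≤ ((K * B) ^ r *
          (C * ∫⁻ t, (∫⁻ x, ‖f (t, x)‖ₑ ^ p) ^ (r / p))) ^ (1 / r) :=
          ENNReal.rpow_le_rpow h3 hr1
      _ = K * B * (C ^ (1 / r) * mixedNorm r p f) := by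
          rw [ENNReal.mul_rpow_of_nonneg _ _ hr1, ENNReal.mul_rpow_of_nonneg _ _ hr1,
            ← ENNReal.rpow_mul, mul_one_div_cancel hr0.ne', ENNReal.rpow_one, mixedNorm]
      _ = K * C ^ (1 / r) * B * mixedNorm r p f := by ring
      _ ≤ _ := by gcongr; exact le_self_add
  by_cases hf0 : mixedNorm r p f = 0
  · have h1 : ∀ z, ‖h z‖ₑ = 0 := fun z => by
      have := hpot z
      rw [rieszPot_eq_zero_of_mixedNorm_eq_zero hp0 hr0 hf hf0 z, mul_zero, mul_zero] at this
      exact le_antisymm this zero_le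
    have h2 : mixedNorm r p h = 0 := by
      simp [mixedNorm, h1, ENNReal.zero_rpow_of_pos hp0, ENNReal.zero_rpow_of_pos hrp, hr0]
    rw [h2]; exact zero_le
  by_cases hMt : morreyNorm α q b = ⊤
  · rw [hMt, ENNReal.mul_top (by simp [hN]), ENNReal.top_mul hf0]
    exact le_top
  -- Division by the Morrey norm is impossible here; the bound is used with `B = 1 / n` and `n → ∞`.
  by_cases hM0 : morreyNorm α q b = 0
  · have hlim : Filter.Tendsto (fun n : ℕ => N * (n : ℝ≥0∞)⁻¹ * mixedNorm r p f) Filter.atTop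
        (nhds (N * 0 * mixedNorm r p f)) :=
      ENNReal.Tendsto.mul_const (ENNReal.Tendsto.const_mul ENNReal.tendsto_inv_nat_nhds_zero
        (Or.inr hNt)) (Or.inr hfin.ne)
    rw [hM0]
    refine ge_of_tendsto hlim ?_
    filter_upwards [Filter.eventually_ge_atTop 1] with n hn
    refine hmain _ (ENNReal.inv_ne_zero.2 (ENNReal.natCast_ne_top n)) (ENNReal.inv_ne_top.2 ?_) ?_
    · exact_mod_cast (by omega : n ≠ 0)
    · rw [hM0]; exact zero_le
  · exact hmain _ hM0 hMt le_rfl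

end

end ParabolicPotential

theorem corollary2p4 (d : ℕ) (hd : 2 ≤ d) (p₀ α k r' s' : ℝ)
    (hp₀ : 1 < p₀) (hp₀d : p₀ ≤ d) (hα : 0 < α) (hαd : α ≤ d / p₀) (hk : 0 < k)
    (hr' : 1 < r') (hr'p₀ : r' < p₀) (hs' : 1 < s') (hs'p₀ : s' < p₀) :
    ∃ N : ℝ≥0, ∀ f : ParabolicPotential.SpaceTime d → ℝ, Measurable f →
      ParabolicPotential.mixedNorm r' s' f < ∞ →
      (∀ᵐ z : ParabolicPotential.SpaceTime d,
        Integrable (ParabolicPotential.potentialIntegrand α k f z)) ∧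
      (∀ b : ParabolicPotential.SpaceTime d → ℝ, Measurable b →
        ParabolicPotential.mixedNorm r' s'
            (fun z => b z * ParabolicPotential.potential α k f z) ≤
          N * ParabolicPotential.morreyNorm α p₀ b * ParabolicPotential.mixedNorm r' s' f) ∧
      (∀ b : ParabolicPotential.SpaceTime d → EuclideanSpace ℝ (Fin d), Measurable b →
        ParabolicPotential.mixedNorm r' s'
            (fun z => ParabolicPotential.potential α k f z • b z) ≤
          N * ParabolicPotential.morreyNorm α p₀ b * ParabolicPotential.mixedNorm r' s' f) := by
  have hαq : α * p₀ ≤ d := (le_div_iff₀ (by linarith)).1 hαd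
  -- Indeed `α ≤ α p₀ ≤ d`; this makes the exponent of the kernel positive.
  have hαd2 : α < d + 2 := by nlinarith
  obtain ⟨N, hN⟩ := ParabolicPotential.mixedNorm_le_of_enorm_le (d := d) hα hαd2 hk hs' hs'p₀ hr'
  obtain ⟨K, hK, hker⟩ := ParabolicPotential.lintegral_potentialIntegrand_le (d := d) hαd2 hk
  refine ⟨N, fun f hf hfin => ⟨?_, fun b hb => ?_, fun b hb => ?_⟩⟩
  · filter_upwards [ParabolicPotential.ae_rieszPot_lt_top hα hs' hs'p₀ hr' hαq hf hfin] with z hz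
    exact ⟨(ParabolicPotential.measurable_potentialIntegrand α k hf z).aestronglyMeasurable,
      (hker f z).trans_lt (ENNReal.mul_lt_top hK.lt_top hz)⟩
  · exact hN f hf hfin b _ hb.enorm fun z => (enorm_mul _ _).le
  · refine hN f hf hfin b _ hb.enorm fun z => ?_
    rw [enorm_smul, mul_comm]
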